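/- For positive integers $n$ and $r$, let $\nu(n,r)$ be the probability that a permutation chosen uniformly at random from the symmetric group $S_n$ has all its cycles of length at most $r$; thus $n!\,\nu(n,r)$ is the number of permutations in $S_n$ with all cycles of length at most $r$. There is an absolute constant $C$ such that for all integers $n$ and $r$ with $2\le r\le \log n$ (natural logarithm), \[ n!\,\nu(n,r)=\frac{1}{\sqrt r}\,n^{n(1-1/r)}\exp\Big\{\sum_{N=0}^{r} d_{rN}\,n^{(r-N)/r}\Big\}\,\big(1+B\,n^{-1/r}\big) \] for some real number $B=B(n,r)$ with $|B|\le C$. Here \[ d_{r0}=-1+\frac1r,\qquad d_{rr}=-\frac1r\sum_{j=2}^{r}\frac1j, \] and \[ d_{rN}=\frac{\Gamma(N+N/r)}{(r-N)\,\Gamma(N+1)\,\Gamma(1+N/r)}\qquad(1\le N\le r-1), \] where $\Gamma$ is Euler's gamma function. -/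

import Mathlib

open scoped Nat

/-- The probability that a uniformly random permutation of `n` letters has only cycles of length
at most `r`.  The parts of `σ.partition` are the lengths of all cycles of `σ`, fixed points
included (as cycles of length `1`). -/
noncomputable def nu (n r : ℕ) : ℝ :=
  (Nat.card {σ : Equiv.Perm (Fin n) // ∀ l ∈ σ.partition.parts, l ≤ r} : ℝ) / (n ! : ℝ)

/-- The coefficients `d_{rN}` for `0 ≤ N ≤ r`. -/
noncomputable def dCoeff (r N : ℕ) : ℝ :=
  if N = 0 then -1 + 1 / (r : ℝ)
  else if N = r then -(1 / (r : ℝ)) * ∑ j ∈ Finset.Icc 2 r, 1 / (j : ℝ)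
  else Real.Gamma ((N : ℝ) + (N : ℝ) / (r : ℝ)) /
    (((r : ℝ) - (N : ℝ)) * Real.Gamma ((N : ℝ) + 1) * Real.Gamma (1 + (N : ℝ) / (r : ℝ)))

open MeasureTheory Filter Topology

/-! The numbers `nu n r` are the Taylor coefficients of `exp (∑ z ^ j / j)`, `1 ≤ j ≤ r`, so
Cauchy's formula writes them as integrals over circles (`circleIntegral_cycle_eq_nu`,
`nu_eq_integral`). The proof is a saddle-point estimate uniform in `r`, combined with Stirling's
formula.

The exact saddle equation is `∑ x ^ j = n` over `1 ≤ j ≤ r`. It is replaced by the geometric series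
continued to all `j ≤ r`, that is `n * (x - 1) = x ^ (r + 1)`. The change costs at most 2 in the
linear term of the phase, and it makes the exponent explicit: with `w = 1 / x` one has `n = x ^ r /
(1 - w)`, hence `n ^ ((r - N) / r) = x ^ (r - N) * (1 - w) ^ (N / r - 1)`. Both the exponent at `x`
and its claimed expansion become `x ^ r` times a power series in `w`. Their coefficients agree
through `w ^ r` (`errCoeff_eq_zero`), by finite-difference identities for the polynomial `∏ ((1 +
1/r) y - j)`. Beyond that they differ by at most `2 * k` at `w ^ (r + k)`, uniformly in `r`, so the
exponent is known up to `8 / x` (`exponent_estimate`).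

On the circle, the phase is close to `-r n θ ^ 2 / 2` for `|θ| ≤ π / r` (`phase_quadratic_le`).
Elsewhere the terms `j = r - 1` and `j = r` together force a decay of `exp (-x ^ (r - 1) / r ^ 3)`
(`phase_re_outer`), which is at most `1 / n` when `r ≤ log n` and `n` is large. The integral is
therefore `√(2π / (r n))` with relative error `O(1 / x)`, and `1 / x ≤ 2 n ^ (-1 / r)`. Finitely
many pairs with small `n` are absorbed in the constant. -/

/-! ### Cycle types and the recurrence for `nu`. -/

/-- The proportion of permutations of `s.sum` letters whose cycle lengths form the multiset `s`. -/
noncomputable def cycleWeight (s : Multiset ℕ) : ℝ :=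
  ((s.prod * ∏ j ∈ s.toFinset, (s.count j)! : ℕ) : ℝ)⁻¹

lemma cycleWeight_cons (j : ℕ) (hj : 1 ≤ j) (t : Multiset ℕ) :
    (j : ℝ) * ((j ::ₘ t).count j : ℝ) * cycleWeight (j ::ₘ t) = cycleWeight t := by
  have key : (j ::ₘ t).prod * ∏ i ∈ (j ::ₘ t).toFinset, ((j ::ₘ t).count i)! =
      j * (j ::ₘ t).count j * (t.prod * ∏ i ∈ t.toFinset, (t.count i)!) := by
    have h1 : ∏ i ∈ t.toFinset, (t.count i)! = ∏ i ∈ insert j t.toFinset, (t.count i)! := by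
      refine Finset.prod_subset (Finset.subset_insert _ _) ?_
      intro x _ hx
      rw [Multiset.mem_toFinset] at hx
      simp [Multiset.count_eq_zero_of_notMem hx]
    rw [Multiset.prod_cons, Multiset.toFinset_cons, h1,
      ← Finset.mul_prod_erase _ _ (Finset.mem_insert_self j t.toFinset),
      ← Finset.mul_prod_erase _ (fun i => (t.count i)!) (Finset.mem_insert_self j t.toFinset),
      Multiset.count_cons_self, Nat.factorial_succ]
    have h2 : ∏ x ∈ (insert j t.toFinset).erase j, (Multiset.count x (j ::ₘ t))! =
        ∏ x ∈ (insert j t.toFinset).erase j, (Multiset.count x t)! := by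
      refine Finset.prod_congr rfl fun x hx => ?_
      rw [Multiset.count_cons_of_ne (Finset.ne_of_mem_erase hx)]
    rw [h2]
    ring
  have hj0 : (j : ℝ) ≠ 0 := by positivity
  have hc : ((j ::ₘ t).count j : ℝ) ≠ 0 := by
    rw [Multiset.count_cons_self]
    positivity
  unfold cycleWeight
  rw [key]
  push_cast
  rw [mul_inv, mul_inv (j : ℝ)]
  field_simp

/-- Expand the sum as `∑ j * count j`; the factor `j * count j` is exactly what the weight loses
when one part `j` is erased. This is the weighted form of marking a letter. -/
lemma sum_mul_cycleWeight_erase (s : Multiset ℕ) (hs : ∀ i ∈ s, 1 ≤ i) :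
    (s.sum : ℝ) * cycleWeight s = ∑ j ∈ s.toFinset, cycleWeight (s.erase j) := by
  rw [Finset.sum_multiset_count, Nat.cast_sum, Finset.sum_mul]
  refine Finset.sum_congr rfl fun j hj => ?_
  rw [Multiset.mem_toFinset] at hj
  have h := cycleWeight_cons j (hs j hj) (s.erase j)
  rw [Multiset.cons_erase hj] at h
  rw [← h, smul_eq_mul]
  push_cast
  ring

lemma partition_parts_eq_filter_add {n : ℕ} (p : n.Partition) :
    p.parts = p.parts.filter (2 ≤ ·) +
      Multiset.replicate (n - (p.parts.filter (2 ≤ ·)).sum) 1 := by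
  have h := Multiset.filter_add_not (fun i => 2 ≤ i) p.parts
  have h1 : p.parts.filter (fun i => ¬ 2 ≤ i) =
      Multiset.replicate (p.parts.filter (fun i => ¬ 2 ≤ i)).card 1 := by
    rw [Multiset.eq_replicate]
    refine ⟨rfl, fun b hb => ?_⟩
    rw [Multiset.mem_filter] at hb
    have := p.parts_pos hb.1
    omega
  have h2 := congrArg Multiset.sum h
  rw [Multiset.sum_add, p.parts_sum, h1, Multiset.sum_replicate] at h2
  have h3 : n - (p.parts.filter (2 ≤ ·)).sum = (p.parts.filter (fun i => ¬ 2 ≤ i)).card := by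
    simp only [smul_eq_mul, mul_one] at h2
    omega
  rw [h3, ← h1]
  exact h.symm

/-- `cycleType` omits fixed points, so the class count is taken for the parts `≥ 2`; the factor `(n
- m.sum)!` appearing there is the factorial of the multiplicity of the part `1`. -/
lemma card_perm_cycle_parts {n : ℕ} (p : n.Partition) :
    ((Finset.univ.filter fun σ : Equiv.Perm (Fin n) => σ.partition.parts = p.parts).card : ℝ) =
      (n ! : ℝ) * cycleWeight p.parts := by
  set m := p.parts.filter (2 ≤ ·) with hm
  have hp := partition_parts_eq_filter_add p
  rw [← hm] at hp
  have hsum : m.sum ≤ n := by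
    have := congrArg Multiset.sum hp
    rw [Multiset.sum_add, p.parts_sum] at this
    omega
  have h1 : (Finset.univ.filter fun σ : Equiv.Perm (Fin n) => σ.partition.parts = p.parts) =
      Finset.univ.filter fun σ : Equiv.Perm (Fin n) => σ.cycleType = m := by
    ext σ
    simp only [Finset.mem_filter, Finset.mem_univ, true_and]
    constructor
    · intro h
      rw [← Equiv.Perm.filter_parts_partition_eq_cycleType, h]
    · intro h
      rw [hp, Equiv.Perm.parts_partition, ← Equiv.Perm.sum_cycleType, h, Fintype.card_fin]
  have h2 := Equiv.Perm.card_of_cycleType_mul_eq (Fin n) m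
  rw [if_pos ⟨by simpa using hsum, fun a ha => (Multiset.mem_filter.1 ha).2⟩,
    Fintype.card_fin] at h2
  have h3 : p.parts.prod * ∏ j ∈ p.parts.toFinset, (p.parts.count j)! =
      (n - m.sum)! * m.prod * ∏ j ∈ m.toFinset, (m.count j)! := by
    have hone : (1 : ℕ) ∉ m.toFinset := by simp [hm]
    have hsub : p.parts.toFinset ⊆ insert 1 m.toFinset := by
      intro x hx
      rw [Multiset.mem_toFinset, hp, Multiset.mem_add] at hx
      rcases hx with hx | hx
      · exact Finset.mem_insert_of_mem (Multiset.mem_toFinset.2 hx)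
      · rw [Multiset.eq_of_mem_replicate hx]
        exact Finset.mem_insert_self _ _
    rw [Finset.prod_subset hsub (fun x _ hx => by
      rw [Multiset.mem_toFinset] at hx
      simp [Multiset.count_eq_zero_of_notMem hx]), Finset.prod_insert hone]
    have hc1 : p.parts.count 1 = n - m.sum := by
      rw [hp, Multiset.count_add, Multiset.count_replicate_self,
        Multiset.count_eq_zero_of_notMem (fun h => hone (Multiset.mem_toFinset.2 h)), zero_add]
    have hc2 : ∏ j ∈ m.toFinset, (p.parts.count j)! = ∏ j ∈ m.toFinset, (m.count j)! := by
      refine Finset.prod_congr rfl fun j hj => ?_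
      have : j ≠ 1 := fun h => hone (h ▸ hj)
      rw [hp, Multiset.count_add, Multiset.count_replicate, if_neg (Ne.symm this), add_zero]
    have hc3 : p.parts.prod = m.prod := by
      rw [hp, Multiset.prod_add, Multiset.prod_replicate, one_pow, mul_one]
    rw [hc1, hc2, hc3]
    ring
  rw [h1]
  unfold cycleWeight
  rw [h3]
  have h4 : ((n - m.sum)! * m.prod * ∏ j ∈ m.toFinset, (m.count j)!) ≠ 0 := by
    intro h
    rw [h, mul_zero] at h2
    exact (Nat.factorial_pos n).ne h2
  rw [eq_mul_inv_iff_mul_eq₀ (by exact_mod_cast h4)]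
  exact_mod_cast h2

/-- The partitions of `n` with all parts at most `r`. -/
def boundedPartitions (n r : ℕ) : Finset n.Partition :=
  Finset.univ.filter fun p => ∀ l ∈ p.parts, l ≤ r

lemma nu_eq_sum_cycleWeight (n r : ℕ) :
    nu n r = ∑ p ∈ boundedPartitions n r, cycleWeight p.parts := by
  classical
  -- `σ.partition` is a partition of `Fintype.card (Fin n)`; `f` retypes it as one of `n`.
  let f : Equiv.Perm (Fin n) → n.Partition := fun σ =>
    ⟨σ.partition.parts, fun {_} h => σ.partition.parts_pos h, by
      simpa using σ.partition.parts_sum⟩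
  have hf : ∀ (σ : Equiv.Perm (Fin n)) (p : n.Partition),
      f σ = p ↔ σ.partition.parts = p.parts := fun σ p =>
    ⟨fun h => h ▸ rfl, fun h => Nat.Partition.ext h⟩
  have hn : (n ! : ℝ) ≠ 0 := by positivity
  unfold nu
  rw [div_eq_iff hn, Finset.sum_mul, Nat.card_eq_fintype_card, Fintype.card_subtype,
    Finset.card_eq_sum_card_fiberwise (f := f) (t := boundedPartitions n r)]
  · push_cast
    refine Finset.sum_congr rfl fun p hp => ?_
    rw [mul_comm, ← card_perm_cycle_parts, Finset.filter_filter]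
    congr 2
    ext σ
    simp only [Finset.mem_filter, Finset.mem_univ, true_and, hf]
    constructor
    · exact fun h => h.2
    · intro h
      exact ⟨h ▸ (Finset.mem_filter.1 hp).2, h⟩
  · intro σ hσ
    simp only [Finset.coe_filter, Finset.mem_univ, true_and, Set.mem_ofPred_eq] at hσ
    exact Finset.mem_coe.2 (Finset.mem_filter.2 ⟨Finset.mem_univ _, hσ⟩)

lemma nu_zero (r : ℕ) : nu 0 r = 1 := by
  rw [nu_eq_sum_cycleWeight]
  have : boundedPartitions 0 r = {Nat.Partition.indiscrete 0} := by
    ext p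
    simp only [boundedPartitions, Finset.mem_filter, Finset.mem_univ, true_and,
      Finset.mem_singleton]
    exact ⟨fun _ => Subsingleton.elim _ _, fun _ => by simp⟩
  rw [this, Finset.sum_singleton]
  simp [cycleWeight]

/-- Marking a letter of the permutation and removing its cycle. -/
lemma nu_recurrence (n r : ℕ) :
    (n : ℝ) * nu n r = ∑ j ∈ (Finset.Icc 1 r).filter (· ≤ n), nu (n - j) r := by
  simp_rw [nu_eq_sum_cycleWeight]
  rw [Finset.mul_sum]
  have h1 : ∀ p ∈ boundedPartitions n r, (n : ℝ) * cycleWeight p.parts =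
      ∑ j ∈ p.parts.toFinset, cycleWeight (p.parts.erase j) := by
    intro p _
    rw [← sum_mul_cycleWeight_erase _ (fun i hi => p.parts_pos hi), p.parts_sum]
  rw [Finset.sum_congr rfl h1]
  rw [Finset.sum_comm' (t' := (Finset.Icc 1 r).filter (· ≤ n))
    (s' := fun j => (boundedPartitions n r).filter (j ∈ ·.parts))]
  · refine Finset.sum_congr rfl fun j hj => ?_
    simp only [Finset.mem_filter, Finset.mem_Icc] at hj
    let e := Nat.Partition.partitionWithPartEquiv hj.1.1 hj.2
    refine Finset.sum_bij' (fun p hp => e ⟨p, (Finset.mem_filter.1 hp).2⟩)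
      (fun q _ => (e.symm q).1) ?_ ?_ ?_ ?_ ?_
    · intro p hp
      simp only [boundedPartitions, Finset.mem_filter, Finset.mem_univ, true_and] at hp ⊢
      intro l hl
      rw [Nat.Partition.partitionWithPartEquiv_apply_parts] at hl
      exact hp.1 l (Multiset.mem_of_mem_erase hl)
    · intro q hq
      simp only [boundedPartitions, Finset.mem_filter, Finset.mem_univ, true_and] at hq ⊢
      refine ⟨fun l hl => ?_, (e.symm q).2⟩
      rw [Nat.Partition.partitionWithPartEquiv_symm_apply_parts, Multiset.mem_cons] at hl
      rcases hl with rfl | hl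
      · exact hj.1.2
      · exact hq l hl
    · intro p hp
      simp
    · intro q hq
      simp
    · intro p hp
      rw [Nat.Partition.partitionWithPartEquiv_apply_parts]
  · intro p j
    simp only [boundedPartitions, Finset.mem_filter, Finset.mem_univ, true_and, Finset.mem_Icc,
      Multiset.mem_toFinset]
    constructor
    · rintro ⟨h, hj⟩
      exact ⟨⟨h, hj⟩, ⟨p.parts_pos hj, h j hj⟩, Nat.Partition.le_of_mem_parts hj⟩
    · rintro ⟨⟨h, hj⟩, -⟩
      exact ⟨h, hj⟩

/-! ### Cauchy's formula for `nu`. -/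

/-- The derivative of `exp P(z) * z ^ (-k)` integrates to zero over the circle, and `P' = ∑ z ^ (j -
1)`. Integer `k` is allowed so that negative indices need no separate recurrence. -/
lemma circleIntegral_cycle_recurrence (r : ℕ) {x : ℝ} (hx : 0 < x) (k : ℤ) :
    (k : ℂ) * ∮ z in C(0, x), Complex.exp (∑ j ∈ Finset.Icc 1 r, z ^ j / j) * z ^ (-k - 1) =
      ∑ j ∈ Finset.Icc 1 r,
        ∮ z in C(0, x), Complex.exp (∑ j ∈ Finset.Icc 1 r, z ^ j / j) * z ^ (-(k - j) - 1) := by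
  have hcont : ∀ m : ℤ, CircleIntegrable
      (fun z : ℂ => Complex.exp (∑ j ∈ Finset.Icc 1 r, z ^ j / j) * z ^ m) 0 x := by
    intro m
    refine ContinuousOn.circleIntegrable hx.le ?_
    refine ContinuousOn.mul (Continuous.continuousOn (by fun_prop)) ?_
    refine continuousOn_id.zpow₀ m fun z hz => Or.inl ?_
    exact ne_zero_of_mem_sphere hx.ne' ⟨z, hz⟩
  have hsum : ∀ z : ℂ, HasDerivAt (fun z : ℂ => ∑ j ∈ Finset.Icc 1 r, z ^ j / (j : ℂ))
      (∑ j ∈ Finset.Icc 1 r, z ^ (j - 1)) z := by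
    intro z
    refine HasDerivAt.fun_sum fun j hj => ?_
    have hj0 : (j : ℂ) ≠ 0 := by
      have := (Finset.mem_Icc.1 hj).1
      exact_mod_cast (by omega : j ≠ 0)
    refine ((hasDerivAt_pow j z).div_const (j : ℂ)).congr_deriv ?_
    rw [mul_div_cancel_left₀ _ hj0]
  have hderiv : ∮ z in C(0, x), ((∑ j ∈ Finset.Icc 1 r,
      Complex.exp (∑ j ∈ Finset.Icc 1 r, z ^ j / j) * z ^ (-(k - j) - 1)) -
      (k : ℂ) • (Complex.exp (∑ j ∈ Finset.Icc 1 r, z ^ j / j) * z ^ (-k - 1))) = 0 := by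
    refine circleIntegral.integral_eq_zero_of_hasDerivWithinAt (f := fun z : ℂ =>
      Complex.exp (∑ j ∈ Finset.Icc 1 r, z ^ j / j) * z ^ (-k)) hx.le fun z hz => ?_
    have hz0 : z ≠ 0 := ne_zero_of_mem_sphere hx.ne' ⟨z, hz⟩
    have h := ((hsum z).cexp.mul (hasDerivAt_zpow (-k) z (Or.inl hz0))).hasDerivWithinAt
      (s := Metric.sphere 0 x)
    refine h.congr_deriv ?_
    have h1 : ∀ j ∈ Finset.Icc 1 r, z ^ (-(k - j) - 1) = z ^ (j - 1) * z ^ (-k) := by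
      intro j hj
      rw [← zpow_natCast z (j - 1), ← zpow_add₀ hz0]
      congr 1
      have := (Finset.mem_Icc.1 hj).1
      push_cast [this]
      ring
    rw [← Finset.mul_sum, Finset.sum_congr rfl h1, ← Finset.sum_mul, smul_eq_mul]
    push_cast
    ring
  have hcs : CircleIntegrable (fun z : ℂ => ∑ j ∈ Finset.Icc 1 r,
      Complex.exp (∑ j ∈ Finset.Icc 1 r, z ^ j / j) * z ^ (-(k - j) - 1)) 0 x :=
    CircleIntegrable.fun_sum _ fun j _ => hcont _
  have hks : CircleIntegrable (fun z : ℂ => (k : ℂ) •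
      (Complex.exp (∑ j ∈ Finset.Icc 1 r, z ^ j / j) * z ^ (-k - 1))) 0 x :=
    (hcont _).const_smul
  rw [circleIntegral.integral_sub hcs hks, circleIntegral.integral_smul,
    sub_eq_zero] at hderiv
  rw [← smul_eq_mul, ← hderiv, circleIntegral.integral_fun_sum fun j _ => hcont _]

lemma circleIntegral_cycle_neg (r : ℕ) {x : ℝ} (hx : 0 < x) {k : ℤ} (hk : k < 0) :
    ∮ z in C(0, x), Complex.exp (∑ j ∈ Finset.Icc 1 r, z ^ j / j) * z ^ (-k - 1) = 0 := by
  obtain ⟨m, hm⟩ := Int.eq_ofNat_of_zero_le (by omega : 0 ≤ -k - 1)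
  simp only [hm, zpow_natCast]
  refine Complex.circleIntegral_eq_zero_of_differentiable_on_off_countable hx.le
    Set.countable_empty (Continuous.continuousOn (by fun_prop)) fun z _ => ?_
  fun_prop

lemma circleIntegral_cycle_zero (r : ℕ) {x : ℝ} (hx : 0 < x) :
    ∮ z in C(0, x), Complex.exp (∑ j ∈ Finset.Icc 1 r, z ^ j / j) * z ^ (-(0 : ℤ) - 1) =
      2 * Real.pi * Complex.I := by
  have h := Complex.circleIntegral_sub_inv_smul_of_differentiable_on_off_countable (c := 0) (R := x)
    (w := 0) (f := fun z : ℂ => Complex.exp (∑ j ∈ Finset.Icc 1 r, z ^ j / j))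
    Set.countable_empty (by simpa using hx) (Continuous.continuousOn (by fun_prop))
    (fun z _ => by fun_prop)
  have h0 : ∑ j ∈ Finset.Icc 1 r, (0 : ℂ) ^ j / j = 0 := by
    refine Finset.sum_eq_zero fun j hj => ?_
    have := (Finset.mem_Icc.1 hj).1
    rw [zero_pow (by omega), zero_div]
  rw [h0, Complex.exp_zero, smul_eq_mul, mul_one] at h
  rw [← h]
  congr 1
  ext z
  rw [sub_zero, smul_eq_mul, mul_comm]
  norm_num [zpow_neg]

/-- Both sides satisfy the same recurrence and agree at `n = 0`. The terms with `j > n`, absent from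
`nu_recurrence`, vanish because their integrand is entire. -/
lemma circleIntegral_cycle_eq_nu (r : ℕ) {x : ℝ} (hx : 0 < x) (n : ℕ) :
    ∮ z in C(0, x), Complex.exp (∑ j ∈ Finset.Icc 1 r, z ^ j / j) * z ^ (-(n : ℤ) - 1) =
      2 * Real.pi * Complex.I * (nu n r : ℂ) := by
  induction n using Nat.strong_induction_on with
  | _ n ih =>
    rcases Nat.eq_zero_or_pos n with rfl | hn
    · simpa [nu_zero] using circleIntegral_cycle_zero r hx
    · have h := circleIntegral_cycle_recurrence r hx n
      have h2 : (n : ℂ) * (nu n r : ℂ) =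
          ∑ j ∈ (Finset.Icc 1 r).filter (· ≤ n), (nu (n - j) r : ℂ) := by
        exact_mod_cast nu_recurrence n r
      have hn0 : (n : ℂ) ≠ 0 := by exact_mod_cast hn.ne'
      rw [← Finset.sum_filter_add_sum_filter_not (Finset.Icc 1 r) (· ≤ n)] at h
      rw [Finset.sum_eq_zero (s := (Finset.Icc 1 r).filter (¬ · ≤ n)), add_zero] at h
      · have h3 : ∀ j ∈ (Finset.Icc 1 r).filter (· ≤ n),
            ∮ z in C(0, x), Complex.exp (∑ j ∈ Finset.Icc 1 r, z ^ j / j) *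
              z ^ (-((n : ℤ) - j) - 1) = 2 * Real.pi * Complex.I * (nu (n - j) r : ℂ) := by
          intro j hj
          simp only [Finset.mem_filter, Finset.mem_Icc] at hj
          rw [← ih (n - j) (by omega), Nat.cast_sub hj.2]
        rw [Finset.sum_congr rfl h3, ← Finset.mul_sum, ← h2] at h
        refine mul_left_cancel₀ hn0 ?_
        rw [← Int.cast_natCast (R := ℂ) n, h]
        push_cast
        ring
      · intro j hj
        simp only [Finset.mem_filter, not_le] at hj
        exact circleIntegral_cycle_neg r hx (by omega)

lemma nu_eq_integral (n r : ℕ) {x : ℝ} (hx : 0 < x) :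
    ((nu n r * x ^ n * Real.exp (-∑ j ∈ Finset.Icc 1 r, x ^ j / j) : ℝ) : ℂ) =
      (2 * Real.pi)⁻¹ * ∫ θ in (-Real.pi)..Real.pi,
        Complex.exp ((∑ j ∈ Finset.Icc 1 r,
          ((x ^ j / j : ℝ) : ℂ) * (Complex.exp (((j * θ : ℝ) : ℂ) * Complex.I) - 1)) -
            ((n * θ : ℝ) : ℂ) * Complex.I) := by
  have hx0 : (x : ℂ) ≠ 0 := by exact_mod_cast hx.ne'
  have h := circleIntegral_cycle_eq_nu r hx n
  set G : ℝ → ℂ := fun θ => Complex.exp ((∑ j ∈ Finset.Icc 1 r,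
          ((x ^ j / j : ℝ) : ℂ) * (Complex.exp (((j * θ : ℝ) : ℂ) * Complex.I) - 1)) -
            ((n * θ : ℝ) : ℂ) * Complex.I) with hG
  have hper : Function.Periodic G (2 * Real.pi) := by
    intro θ
    simp only [hG]
    have h1 : ∀ j : ℕ, Complex.exp (((j * (θ + 2 * Real.pi) : ℝ) : ℂ) * Complex.I) =
        Complex.exp (((j * θ : ℝ) : ℂ) * Complex.I) := by
      intro j
      have := Complex.exp_periodic.nat_mul j (((j * θ : ℝ) : ℂ) * Complex.I)
      rw [← this]
      congr 1
      push_cast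
      ring
    simp_rw [h1]
    have := Complex.exp_periodic.neg.nat_mul n ((∑ j ∈ Finset.Icc 1 r,
          ((x ^ j / j : ℝ) : ℂ) * (Complex.exp (((j * θ : ℝ) : ℂ) * Complex.I) - 1)) -
            ((n * θ : ℝ) : ℂ) * Complex.I)
    rw [← this]
    congr 1
    push_cast
    ring
  have hshift : ∫ θ in (-Real.pi)..Real.pi, G θ = ∫ θ in (0 : ℝ)..2 * Real.pi, G θ := by
    have := hper.intervalIntegral_add_eq (-Real.pi) 0
    rw [zero_add] at this
    rw [← this]
    congr 1
    ring
  rw [hshift]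
  have hpt : ∀ θ : ℝ, deriv (circleMap 0 x) θ • (Complex.exp (∑ j ∈ Finset.Icc 1 r,
      circleMap 0 x θ ^ j / j) * circleMap 0 x θ ^ (-(n : ℤ) - 1)) =
      (Complex.I * ((x : ℂ) ^ n)⁻¹ * Complex.exp (∑ j ∈ Finset.Icc 1 r, (x : ℂ) ^ j / j)) *
        G θ := by
    intro θ
    have hz : circleMap 0 x θ = x * Complex.exp (θ * Complex.I) := by simp [circleMap]
    have hz0 : circleMap 0 x θ ≠ 0 := by
      rw [hz]
      exact mul_ne_zero hx0 (Complex.exp_ne_zero _)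
    have hpow : ∀ j : ℕ, circleMap 0 x θ ^ j =
        (x : ℂ) ^ j * Complex.exp (((j * θ : ℝ) : ℂ) * Complex.I) := by
      intro j
      rw [hz, mul_pow, ← Complex.exp_nat_mul]
      push_cast
      ring_nf
    have hzp : circleMap 0 x θ * circleMap 0 x θ ^ (-(n : ℤ) - 1) =
        ((x : ℂ) ^ n)⁻¹ * Complex.exp (-(((n * θ : ℝ) : ℂ) * Complex.I)) := by
      rw [zpow_sub₀ hz0, zpow_neg, zpow_natCast, zpow_one, hpow, mul_inv, Complex.exp_neg]
      field_simp
    rw [deriv_circleMap, smul_eq_mul, hG]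
    simp_rw [hpow]
    have hE : Complex.exp ((∑ j ∈ Finset.Icc 1 r,
          ((x ^ j / j : ℝ) : ℂ) * (Complex.exp (((j * θ : ℝ) : ℂ) * Complex.I) - 1)) -
            ((n * θ : ℝ) : ℂ) * Complex.I) *
          Complex.exp (∑ j ∈ Finset.Icc 1 r, (x : ℂ) ^ j / j) =
        Complex.exp (∑ j ∈ Finset.Icc 1 r,
          (x : ℂ) ^ j * Complex.exp (((j * θ : ℝ) : ℂ) * Complex.I) / j) *
          Complex.exp (-(((n * θ : ℝ) : ℂ) * Complex.I)) := by
      rw [← Complex.exp_add, ← Complex.exp_add]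
      congr 1
      have : ∑ j ∈ Finset.Icc 1 r,
          (x : ℂ) ^ j * Complex.exp (((j * θ : ℝ) : ℂ) * Complex.I) / j =
          (∑ j ∈ Finset.Icc 1 r,
          ((x ^ j / j : ℝ) : ℂ) * (Complex.exp (((j * θ : ℝ) : ℂ) * Complex.I) - 1)) +
          ∑ j ∈ Finset.Icc 1 r, (x : ℂ) ^ j / j := by
        rw [← Finset.sum_add_distrib]
        refine Finset.sum_congr rfl fun j _ => ?_
        push_cast
        ring
      rw [this]
      ring
    calc _ = Complex.I * Complex.exp (∑ j ∈ Finset.Icc 1 r,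
          (x : ℂ) ^ j * Complex.exp (((j * θ : ℝ) : ℂ) * Complex.I) / j) *
          (circleMap 0 x θ * circleMap 0 x θ ^ (-(n : ℤ) - 1)) := by ring
      _ = _ := by
        rw [hzp]
        linear_combination (-Complex.I * ((x : ℂ) ^ n)⁻¹) * hE
  rw [circleIntegral, intervalIntegral.integral_congr (fun θ _ => hpt θ),
    intervalIntegral.integral_const_mul] at h
  have hpi : (Real.pi : ℂ) ≠ 0 := by exact_mod_cast Real.pi_ne_zero
  have hI : (∫ θ in (0 : ℝ)..2 * Real.pi, G θ) = 2 * Real.pi * (nu n r : ℂ) * (x : ℂ) ^ n *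
      Complex.exp (-∑ j ∈ Finset.Icc 1 r, (x : ℂ) ^ j / j) := by
    rw [Complex.exp_neg]
    have h1 := Complex.exp_ne_zero (∑ j ∈ Finset.Icc 1 r, (x : ℂ) ^ j / j)
    have h2 := Complex.I_ne_zero
    have h3 := pow_ne_zero n hx0
    rw [eq_mul_inv_iff_mul_eq₀ h1]
    refine mul_left_cancel₀ (mul_ne_zero h2 (inv_ne_zero h3)) ?_
    rw [mul_assoc, mul_comm (∫ θ in (0 : ℝ)..2 * Real.pi, G θ), ← mul_assoc, ← mul_assoc, h]
    field_simp
  rw [hI]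
  push_cast
  field_simp

/-! ### Finite-difference identities. -/

open Polynomial in
lemma sum_alternating_choose_mul_eval_eq_zero {m : ℕ} (p : ℝ[X]) (hp : p.natDegree < m) :
    ∑ N ∈ Finset.range (m + 1), (-1 : ℝ) ^ (m - N) * (m.choose N : ℝ) * p.eval (N : ℝ) = 0 := by
  have h := congrFun (Polynomial.fwdDiff_iter_eq_zero_of_degree_lt hp) 0
  rw [fwdDiff_iter_eq_sum_shift] at h
  simpa using h

open Polynomial in
/-- Partial-fraction form of the vanishing of the `m`-th difference of `(p(y) - p(a)) / (y - a)`. -/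
lemma exists_difference_quotient {m : ℕ} (p : ℝ[X]) (hp : p.natDegree ≤ m) (hm : 0 < m) (a : ℝ) :
    ∃ q : ℝ[X], p = C (p.eval a) + (X - C a) * q ∧ q.eval a = p.derivative.eval a ∧
      ∑ N ∈ Finset.range (m + 1), (-1 : ℝ) ^ (m - N) * (m.choose N : ℝ) * q.eval (N : ℝ) = 0 := by
  set q := p /ₘ (X - C a) with hq
  have h1 : p = C (p.eval a) + (X - C a) * q := by
    have := X_sub_C_mul_divByMonic_eq_sub_modByMonic p a
    rw [modByMonic_X_sub_C_eq_C_eval] at this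
    rw [hq, this]
    ring
  refine ⟨q, h1, ?_, sum_alternating_choose_mul_eval_eq_zero q ?_⟩
  · have h2 := congrArg (fun f => f.derivative.eval a) h1
    simp only [derivative_add, derivative_C, derivative_mul, derivative_sub, derivative_X, eval_add,
      eval_mul, eval_sub, eval_X, eval_C, sub_self, zero_mul, sub_zero, one_mul,
      zero_add, add_zero] at h2
    exact h2.symm
  · rw [hq, natDegree_divByMonic p (monic_X_sub_C a), natDegree_X_sub_C]
    omega

open Polynomial in
/-- The polynomial `∏_{j=1}^m ((1 + b) y - j)`. -/
noncomputable def stretchedPoly (b : ℝ) (m : ℕ) : ℝ[X] :=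
  ∏ j ∈ Finset.range m, (C (1 + b) * X - C ((j : ℝ) + 1))

lemma stretchedPoly_eval (b : ℝ) (m : ℕ) (y : ℝ) :
    (stretchedPoly b m).eval y = ∏ j ∈ Finset.range m, ((1 + b) * y - ((j : ℝ) + 1)) := by
  simp [stretchedPoly, Polynomial.eval_prod]

lemma stretchedPoly_natDegree_le (b : ℝ) (m : ℕ) : (stretchedPoly b m).natDegree ≤ m := by
  refine (Polynomial.natDegree_prod_le _ _).trans ?_
  refine (Finset.sum_le_sum (g := fun _ => 1) fun j _ => ?_).trans (by simp)
  exact Polynomial.natDegree_linear_le (a := 1 + b) (b := -((j : ℝ) + 1)) |>.trans' (by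
    rw [Polynomial.C_neg, sub_eq_add_neg])

/-- Harmonic numbers as reals. -/
noncomputable def harm (m : ℕ) : ℝ := ∑ j ∈ Finset.range m, 1 / ((j : ℝ) + 1)

lemma harm_succ (m : ℕ) : harm (m + 1) = harm m + 1 / ((m : ℝ) + 1) :=
  Finset.sum_range_succ _ _

lemma harm_le (m : ℕ) : harm m ≤ m := by
  refine (Finset.sum_le_sum (g := fun _ => (1 : ℝ)) fun j _ => ?_).trans (by simp)
  rw [div_le_one (by positivity)]
  linarith [(Nat.cast_nonneg j : (0 : ℝ) ≤ j)]

lemma one_le_harm {m : ℕ} (hm : 1 ≤ m) : 1 ≤ harm m := by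
  obtain ⟨k, rfl⟩ := Nat.exists_eq_add_of_le' hm
  unfold harm
  rw [Finset.sum_range_succ']
  have : 0 ≤ ∑ j ∈ Finset.range k, 1 / (((j + 1 : ℕ) : ℝ) + 1) :=
    Finset.sum_nonneg fun j _ => by positivity
  simpa using this

lemma stretchedPoly_eval_zero (b : ℝ) (m : ℕ) :
    (stretchedPoly b m).eval 0 = (-1) ^ m * (m ! : ℝ) := by
  induction m with
  | zero => simp [stretchedPoly]
  | succ m ih =>
    rw [stretchedPoly_eval] at ih ⊢
    rw [Finset.prod_range_succ, ih, Nat.factorial_succ]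
    push_cast
    ring

lemma stretchedPoly_derivative_eval_zero (b : ℝ) (m : ℕ) :
    (stretchedPoly b m).derivative.eval 0 = -(1 + b) * harm m * ((-1) ^ m * (m ! : ℝ)) := by
  induction m with
  | zero => simp [stretchedPoly, harm]
  | succ m ih =>
    have h0 := stretchedPoly_eval_zero b m
    unfold stretchedPoly at ih h0 ⊢
    rw [Finset.prod_range_succ, Polynomial.derivative_mul, Polynomial.eval_add,
      Polynomial.eval_mul, Polynomial.eval_mul, ih, h0, harm_succ, Nat.factorial_succ]
    simp
    field_simp
    ring

lemma sum_range_succ_eq_zero_add_sum_Icc (f : ℕ → ℝ) (m : ℕ) :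
    ∑ N ∈ Finset.range (m + 1), f N = f 0 + ∑ N ∈ Finset.Icc 1 m, f N := by
  rw [Finset.sum_range_succ', add_comm]
  congr 1
  exact Finset.sum_bij (fun i _ => i + 1) (by simp) (by simp)
    (fun b hb => ⟨b - 1, by simp at hb ⊢; omega, by simp at hb; omega⟩) (by simp)

/-- Take the difference quotient at `a = 0`: the node `N = 0` contributes the derivative there, and
the subtracted constant `p(0)` produces the sum on the right. -/
lemma sum_stretchedPoly_div_aux (b : ℝ) {m : ℕ} (hm : 0 < m) :
    ∑ N ∈ Finset.Icc 1 m, (-1 : ℝ) ^ (m - N) * (m.choose N : ℝ) *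
      ((stretchedPoly b m).eval (N : ℝ) / N) =
      (1 + b) * harm m * (m ! : ℝ) + (-1) ^ m * (m ! : ℝ) *
        ∑ N ∈ Finset.Icc 1 m, (-1 : ℝ) ^ (m - N) * (m.choose N : ℝ) / N := by
  obtain ⟨q, h1, h2, h3⟩ :=
    exists_difference_quotient (stretchedPoly b m) (stretchedPoly_natDegree_le b m) hm 0
  rw [sum_range_succ_eq_zero_add_sum_Icc] at h3
  rw [stretchedPoly_derivative_eval_zero] at h2
  rw [Nat.cast_zero, h2] at h3
  have h4 : ∀ N ∈ Finset.Icc 1 m, (-1 : ℝ) ^ (m - N) * (m.choose N : ℝ) *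
      ((stretchedPoly b m).eval (N : ℝ) / N) =
      (-1 : ℝ) ^ (m - N) * (m.choose N : ℝ) * q.eval (N : ℝ) +
        (-1) ^ m * (m ! : ℝ) * ((-1 : ℝ) ^ (m - N) * (m.choose N : ℝ) / N) := by
    intro N hN
    have hN0 : (N : ℝ) ≠ 0 := by
      have := (Finset.mem_Icc.1 hN).1
      positivity
    have h5 := congrArg (Polynomial.eval (N : ℝ)) h1
    rw [stretchedPoly_eval_zero] at h5
    simp only [Polynomial.eval_add, Polynomial.eval_mul, Polynomial.eval_sub, Polynomial.eval_X,
      Polynomial.eval_C, sub_zero] at h5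
    rw [h5]
    field_simp
    ring
  rw [Finset.sum_congr rfl h4, Finset.sum_add_distrib, ← Finset.mul_sum]
  have h6 : (-1 : ℝ) ^ m * (-1) ^ m = 1 := by rw [← mul_pow]; simp
  simp only [Nat.sub_zero, Nat.choose_zero_right, Nat.cast_one, mul_one] at h3
  linear_combination h3 + (1 + b) * harm m * (m ! : ℝ) * h6

/-- The case `b = 0` of the preceding identity, where the polynomial vanishes at every node `1, ...,
m`. -/
lemma sum_alternating_choose_div (m : ℕ) (hm : 0 < m) :
    (-1 : ℝ) ^ m * ∑ N ∈ Finset.Icc 1 m, (-1 : ℝ) ^ (m - N) * (m.choose N : ℝ) / N = -harm m := by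
  have h := sum_stretchedPoly_div_aux 0 hm
  rw [Finset.sum_eq_zero] at h
  · have hf : (m ! : ℝ) ≠ 0 := by positivity
    refine mul_left_cancel₀ hf ?_
    linear_combination -h
  · intro N hN
    rw [stretchedPoly_eval, Finset.prod_eq_zero (i := N - 1)]
    · simp
    · have := Finset.mem_Icc.1 hN
      exact Finset.mem_range.2 (by omega)
    · rw [Nat.cast_sub (Finset.mem_Icc.1 hN).1]
      push_cast
      ring

lemma sum_stretchedPoly_div (b : ℝ) {m : ℕ} (hm : 0 < m) :
    ∑ N ∈ Finset.Icc 1 m, (-1 : ℝ) ^ (m - N) * (m.choose N : ℝ) *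
      ((stretchedPoly b m).eval (N : ℝ) / N) = b * harm m * (m ! : ℝ) := by
  rw [sum_stretchedPoly_div_aux b hm]
  linear_combination (m ! : ℝ) * sum_alternating_choose_div m hm

/-- Subtracting `p(a)` cancels the pole at `a` and leaves a quotient of degree below `m`, whose
`m`-th difference is zero. Hence only the value `p(a)` matters. -/
lemma sum_poly_div_sub {m : ℕ} (p : Polynomial ℝ) (hp : p.natDegree ≤ m) (hm : 0 < m) (a : ℝ)
    (ha : (m : ℝ) < a) :
    ∑ N ∈ Finset.range (m + 1), (-1 : ℝ) ^ (m - N) * (m.choose N : ℝ) *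
      (p.eval (N : ℝ) / (a - N)) =
    p.eval a * ∑ N ∈ Finset.range (m + 1), (-1 : ℝ) ^ (m - N) * (m.choose N : ℝ) / (a - N) := by
  obtain ⟨q, h1, -, h3⟩ := exists_difference_quotient p hp hm a
  have h4 : ∀ N ∈ Finset.range (m + 1), (-1 : ℝ) ^ (m - N) * (m.choose N : ℝ) *
      (p.eval (N : ℝ) / (a - N)) =
      p.eval a * ((-1 : ℝ) ^ (m - N) * (m.choose N : ℝ) / (a - N)) -
      (-1 : ℝ) ^ (m - N) * (m.choose N : ℝ) * q.eval (N : ℝ) := by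
    intro N hN
    have hN' : (N : ℝ) ≤ m := by exact_mod_cast Nat.lt_succ_iff.1 (Finset.mem_range.1 hN)
    have h0 : a - N ≠ 0 := by linarith
    have h5 := congrArg (Polynomial.eval (N : ℝ)) h1
    simp only [Polynomial.eval_add, Polynomial.eval_mul, Polynomial.eval_sub, Polynomial.eval_X,
      Polynomial.eval_C] at h5
    rw [h5]
    field_simp
    ring
  rw [Finset.sum_congr rfl h4, Finset.sum_sub_distrib, h3, sub_zero, Finset.mul_sum]

/-- For `b = 1 / r` the factors at `y = r` are `r - j`, so the polynomial can be exchanged for `∏ (y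
- j)`, which vanishes at the nodes `0, ..., m - 1` and leaves only `N = m`. -/
lemma sum_stretchedPoly_div_sub {r m : ℕ} (hm : 0 < m) (hr : m < r) :
    ∑ N ∈ Finset.range (m + 1), (-1 : ℝ) ^ (m - N) * (m.choose N : ℝ) *
      ((stretchedPoly (1 / r) m).eval (N : ℝ) / ((r : ℝ) - N)) = (m ! : ℝ) / ((r : ℝ) - m) := by
  have hr' : (m : ℝ) < r := by exact_mod_cast hr
  have hr0 : (r : ℝ) ≠ 0 := Nat.cast_ne_zero.2 (by omega)
  have h1 := sum_poly_div_sub (stretchedPoly (1 / r) m) (stretchedPoly_natDegree_le _ m) hm r hr'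
  set R : Polynomial ℝ := ∏ j ∈ Finset.range m, (Polynomial.X - Polynomial.C (j : ℝ)) with hR
  have hRd : R.natDegree ≤ m := by
    refine (Polynomial.natDegree_prod_le _ _).trans ?_
    exact (Finset.sum_le_sum (g := fun _ => 1) fun j _ =>
      (Polynomial.natDegree_X_sub_C _).le).trans (by simp)
  have hRe : ∀ y, R.eval y = ∏ j ∈ Finset.range m, (y - (j : ℝ)) := by
    intro y
    simp [hR, Polynomial.eval_prod]
  have h2 := sum_poly_div_sub R hRd hm r hr'
  rw [Finset.sum_range_succ, Finset.sum_eq_zero, zero_add] at h2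
  · have h3 : (stretchedPoly (1 / r) m).eval (r : ℝ) = R.eval (r : ℝ) := by
      rw [stretchedPoly_eval, hRe]
      refine Finset.prod_congr rfl fun j _ => ?_
      field_simp
      ring
    have h4 : R.eval (m : ℝ) = m ! := by
      rw [hRe, ← Finset.prod_range_reflect, ← Finset.prod_range_add_one_eq_factorial, Nat.cast_prod]
      refine Finset.prod_congr rfl fun j hj => ?_
      have := Finset.mem_range.1 hj
      rw [Nat.sub_sub, Nat.cast_sub (by omega)]
      push_cast
      ring
    rw [h1, h3, ← h2, h4]
    simp
  · intro N hN
    rw [hRe, Finset.prod_eq_zero hN (sub_self _)]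
    simp

/-! ### Convolution of the coefficients `d_{rN}` with binomial coefficients. -/

/-- The coefficient `d_{rN}` as a finite product, for `1 ≤ N < r`. -/
noncomputable def expCoeff (r N : ℕ) : ℝ :=
  (∏ i ∈ Finset.range (N - 1), ((N : ℝ) / r + (i + 1))) / (((r : ℝ) - N) * (N ! : ℝ))

/-- The coefficient of `w ^ k` in `(1 - w) ^ (γ - 1)`. -/
noncomputable def binCoeff (γ : ℝ) (k : ℕ) : ℝ :=
  (∏ i ∈ Finset.range k, ((i : ℝ) + 1 - γ)) / (k ! : ℝ)

/-- Split the product at `j = N`: the positive factors, read backwards, give the numerator of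
`expCoeff` times `N / r`; the remaining ones give that of `binCoeff` up to sign. -/
lemma stretchedPoly_eval_nat {r m N : ℕ} (hN : 1 ≤ N) (hNm : N ≤ m) :
    (stretchedPoly (1 / r) m).eval (N : ℝ) = (N : ℝ) / r *
      (∏ i ∈ Finset.range (N - 1), ((N : ℝ) / r + (i + 1))) * ((-1) ^ (m - N) *
        ∏ i ∈ Finset.range (m - N), ((i : ℝ) + 1 - (N : ℝ) / r)) := by
  obtain ⟨k, rfl⟩ := Nat.exists_eq_add_of_le hNm
  obtain ⟨M, rfl⟩ := Nat.exists_eq_add_of_le' hN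
  rw [stretchedPoly_eval, Finset.prod_range_add, ← Finset.prod_range_reflect,
    Finset.prod_range_succ']
  rw [show M + 1 + k - (M + 1) = k by omega, show M + 1 - 1 = M by omega]
  congr 1
  · rw [mul_comm]
    congr 1
    · rw [Nat.sub_zero]
      push_cast
      ring
    · refine Finset.prod_congr rfl fun i hi => ?_
      have := Finset.mem_range.1 hi
      rw [Nat.cast_sub (by omega)]
      push_cast
      ring
  · rw [← Finset.card_range k, ← Finset.prod_const, Finset.card_range, ← Finset.prod_mul_distrib]
    refine Finset.prod_congr rfl fun i _ => ?_
    push_cast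
    ring

/-- Uses the partial fraction `1 / (r - N) = (N / r) * (1 / N + 1 / (r - N))`, which reduces the
convolution to the two difference sums above. -/
lemma expCoeff_mul_binCoeff {r m N : ℕ} (hN : 1 ≤ N) (hNm : N ≤ m) (hNr : N < r) :
    expCoeff r N * binCoeff ((N : ℝ) / r) (m - N) =
      1 / (m ! : ℝ) * ((-1 : ℝ) ^ (m - N) * (m.choose N : ℝ) *
        ((stretchedPoly (1 / r) m).eval (N : ℝ) / N) + (-1 : ℝ) ^ (m - N) * (m.choose N : ℝ) *
        ((stretchedPoly (1 / r) m).eval (N : ℝ) / ((r : ℝ) - N))) := by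
  have h1 : (-1 : ℝ) ^ (m - N) * (-1) ^ (m - N) = 1 := by rw [← mul_pow]; simp
  have h2 : (r : ℝ) - N ≠ 0 := by
    have : (N : ℝ) < r := by exact_mod_cast hNr
    linarith
  have h3 : (N : ℝ) ≠ 0 := by positivity
  have h4 : (r : ℝ) ≠ 0 := by
    have : 0 < r := by omega
    positivity
  rw [stretchedPoly_eval_nat hN hNm, Nat.cast_choose ℝ hNm]
  unfold expCoeff binCoeff
  generalize ∏ i ∈ Finset.range (N - 1), ((N : ℝ) / r + (i + 1)) = A
  generalize ∏ i ∈ Finset.range (m - N), ((i : ℝ) + 1 - (N : ℝ) / r) = B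
  have h5 : (m ! : ℝ) ≠ 0 := by positivity
  have h6 : (N ! : ℝ) ≠ 0 := by positivity
  have h7 : ((m - N)! : ℝ) ≠ 0 := by positivity
  generalize (-1 : ℝ) ^ (m - N) = s at *
  field_simp
  linear_combination (-A * B * r) * h1

/-- The `m`-th coefficient in the expansion of `∑ d_{rN} w ^ N (1 - w) ^ (N / r - 1)`. -/
noncomputable def convCoeff (r m : ℕ) : ℝ :=
  ∑ N ∈ Finset.Icc 1 (r - 1), if N ≤ m then expCoeff r N * binCoeff ((N : ℝ) / r) (m - N) else 0

lemma convCoeff_eq_of_lt {r m : ℕ} (hm : m < r) :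
    convCoeff r m = 1 / ((r : ℝ) - m) + 1 / r * (harm m - 1) := by
  have hr : (r : ℝ) ≠ 0 := by
    have : 0 < r := by omega
    positivity
  rcases Nat.eq_zero_or_pos m with rfl | hm0
  · unfold convCoeff
    rw [Finset.sum_eq_zero]
    · simp [harm]
    · intro N hN
      rw [if_neg]
      have := Finset.mem_Icc.1 hN
      omega
  · have h1 : convCoeff r m =
        ∑ N ∈ Finset.Icc 1 m, expCoeff r N * binCoeff ((N : ℝ) / r) (m - N) := by
      unfold convCoeff
      rw [← Finset.sum_filter]
      refine Finset.sum_congr ?_ fun _ _ => rfl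
      ext N
      simp only [Finset.mem_filter, Finset.mem_Icc]
      omega
    rw [h1, Finset.sum_congr rfl fun N hN => expCoeff_mul_binCoeff (Finset.mem_Icc.1 hN).1
      (Finset.mem_Icc.1 hN).2 ((Finset.mem_Icc.1 hN).2.trans_lt hm), ← Finset.mul_sum,
      Finset.sum_add_distrib, sum_stretchedPoly_div _ hm0]
    have h2 := sum_stretchedPoly_div_sub hm0 hm
    rw [sum_range_succ_eq_zero_add_sum_Icc, Nat.cast_zero, stretchedPoly_eval_zero] at h2
    have h6 : (-1 : ℝ) ^ m * (-1) ^ m = 1 := by rw [← mul_pow]; simp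
    simp only [Nat.sub_zero, Nat.choose_zero_right, Nat.cast_one, mul_one, sub_zero] at h2
    have h3 : ∑ N ∈ Finset.Icc 1 m, (-1 : ℝ) ^ (m - N) * (m.choose N : ℝ) *
      ((stretchedPoly (1 / r) m).eval (N : ℝ) / ((r : ℝ) - N)) =
      (m ! : ℝ) / ((r : ℝ) - m) - (m ! : ℝ) / r := by
      linear_combination h2 - (m ! : ℝ) / r * h6
    rw [h3]
    have h5 : (m ! : ℝ) ≠ 0 := by positivity
    have h7 : (r : ℝ) - m ≠ 0 := by
      have : (m : ℝ) < r := by exact_mod_cast hm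
      linarith
    field_simp
    ring

lemma stretchedPoly_eval_reflect {r N : ℕ} (hr : 0 < r) (hN : N ≤ r) :
    (stretchedPoly (1 / r) r).eval ((r - N : ℕ) : ℝ) =
      (-1) ^ r * (stretchedPoly (1 / r) r).eval (N : ℝ) := by
  have hr0 : (r : ℝ) ≠ 0 := by positivity
  rw [stretchedPoly_eval, stretchedPoly_eval, ← Finset.prod_range_reflect]
  have hconst : (-1 : ℝ) ^ r = ∏ _j ∈ Finset.range r, (-1) := by simp
  rw [hconst, ← Finset.prod_mul_distrib]
  refine Finset.prod_congr rfl fun i hi => ?_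
  have := Finset.mem_range.1 hi
  rw [Nat.sub_sub, Nat.cast_sub hN, Nat.cast_sub (by omega)]
  push_cast
  field_simp
  ring

/-- At `m = r` the pole `r - N` meets the node `r`. The reflection `N ↦ r - N` turns the sum over `1
/ (r - N)` into the sum over `1 / N`, whence the factor 2. -/
lemma convCoeff_self {r : ℕ} (hr : 2 ≤ r) :
    convCoeff r r = 2 * (1 / r * (harm r - 1)) := by
  have hr0 : (r : ℝ) ≠ 0 := by positivity
  have h1 : convCoeff r r =
      ∑ N ∈ Finset.Icc 1 (r - 1), expCoeff r N * binCoeff ((N : ℝ) / r) (r - N) := by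
    refine Finset.sum_congr rfl fun N hN => if_pos ?_
    have := Finset.mem_Icc.1 hN
    omega
  have hA := sum_stretchedPoly_div (1 / (r : ℝ)) (m := r) (by omega)
  have hIcc : Finset.Icc 1 r = insert r (Finset.Icc 1 (r - 1)) := by
    ext i
    simp only [Finset.mem_Icc, Finset.mem_insert]
    omega
  rw [hIcc, Finset.sum_insert (by simp; omega)] at hA
  have hrr : (stretchedPoly (1 / r) r).eval (r : ℝ) = r ! := by
    have h := stretchedPoly_eval_reflect (r := r) (N := 0) (by omega) (by omega)
    rw [Nat.sub_zero, Nat.cast_zero, stretchedPoly_eval_zero, ← mul_assoc, ← mul_pow] at h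
    simpa using h
  rw [hrr] at hA
  simp only [Nat.sub_self, pow_zero, Nat.choose_self, Nat.cast_one, mul_one, one_mul] at hA
  have hB : ∑ N ∈ Finset.Icc 1 (r - 1), (-1 : ℝ) ^ (r - N) * (r.choose N : ℝ) *
        ((stretchedPoly (1 / r) r).eval (N : ℝ) / ((r : ℝ) - N)) =
      ∑ N ∈ Finset.Icc 1 (r - 1), (-1 : ℝ) ^ (r - N) * (r.choose N : ℝ) *
        ((stretchedPoly (1 / r) r).eval (N : ℝ) / N) := by
    refine Finset.sum_nbij' (fun N => r - N) (fun N => r - N) ?_ ?_ ?_ ?_ ?_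
    · intro N hN; simp only [Finset.mem_Icc] at hN ⊢; omega
    · intro N hN; simp only [Finset.mem_Icc] at hN ⊢; omega
    · intro N hN; simp only [Finset.mem_Icc] at hN; omega
    · intro N hN; simp only [Finset.mem_Icc] at hN; omega
    · intro N hN
      simp only [Finset.mem_Icc] at hN
      have hNr : N ≤ r := by omega
      have hs : (-1 : ℝ) ^ r = (-1) ^ (r - N) * (-1) ^ N := by
        rw [← pow_add, Nat.sub_add_cancel hNr]
      have hs2 : (-1 : ℝ) ^ N * (-1) ^ N = 1 := by rw [← mul_pow]; simp
      rw [stretchedPoly_eval_reflect (by omega) hNr, Nat.choose_symm hNr, Nat.cast_sub hNr,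
        Nat.sub_sub_self hNr, hs]
      linear_combination (-((-1 : ℝ) ^ (r - N) * (r.choose N : ℝ) *
        ((stretchedPoly (1 / r) r).eval (N : ℝ) / ((r : ℝ) - N)))) * hs2
  rw [h1, Finset.sum_congr rfl fun N hN => expCoeff_mul_binCoeff (Finset.mem_Icc.1 hN).1
      (by have := Finset.mem_Icc.1 hN; omega) (by have := Finset.mem_Icc.1 hN; omega),
      ← Finset.mul_sum, Finset.sum_add_distrib, hB, ← two_mul]
  have h5 : (r ! : ℝ) ≠ 0 := by positivity
  have hC : ∑ N ∈ Finset.Icc 1 (r - 1), (-1 : ℝ) ^ (r - N) * (r.choose N : ℝ) *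
        ((stretchedPoly (1 / r) r).eval (N : ℝ) / N) =
      1 / (r : ℝ) * harm r * (r ! : ℝ) - (r ! : ℝ) / r := by
    linear_combination hA
  rw [hC]
  field_simp

lemma expCoeff_nonneg {r N : ℕ} (hN : N < r) : 0 ≤ expCoeff r N := by
  have : (N : ℝ) < r := by exact_mod_cast hN
  unfold expCoeff
  refine div_nonneg (Finset.prod_nonneg fun i _ => by positivity)
    (mul_nonneg (by linarith) (by positivity))

lemma binCoeff_nonneg {γ : ℝ} (hγ : γ ≤ 1) (k : ℕ) : 0 ≤ binCoeff γ k := by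
  refine div_nonneg (Finset.prod_nonneg fun i _ => ?_) (by positivity)
  have : (0 : ℝ) ≤ i := Nat.cast_nonneg i
  linarith

lemma binCoeff_antitone {γ : ℝ} (h0 : 0 ≤ γ) (hγ : γ ≤ 1) : Antitone (binCoeff γ) := by
  refine antitone_nat_of_succ_le fun k => ?_
  have h1 : binCoeff γ (k + 1) = binCoeff γ k * (((k : ℝ) + 1 - γ) / ((k : ℝ) + 1)) := by
    unfold binCoeff
    rw [Finset.prod_range_succ, Nat.factorial_succ]
    push_cast
    field_simp
  rw [h1]
  refine mul_le_of_le_one_right (binCoeff_nonneg hγ k) ?_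
  rw [div_le_one (by positivity)]
  linarith

/-- All terms are nonnegative, and for `m ≥ r` each decreases in `m` because `binCoeff` does; so the
explicit value at `m = r` bounds them all, uniformly in `r`. -/
lemma convCoeff_bounds {r m : ℕ} (hr : 2 ≤ r) (hm : r ≤ m) :
    0 ≤ convCoeff r m ∧ convCoeff r m ≤ 2 := by
  have hr0 : (0 : ℝ) < r := by positivity
  have hγ : ∀ N ∈ Finset.Icc 1 (r - 1), (N : ℝ) / r ≤ 1 := by
    intro N hN
    rw [div_le_one hr0]
    have := Finset.mem_Icc.1 hN
    exact_mod_cast (by omega : N ≤ r)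
  constructor
  · refine Finset.sum_nonneg fun N hN => ?_
    split_ifs
    · refine mul_nonneg (expCoeff_nonneg ?_) (binCoeff_nonneg (hγ N hN) _)
      have := Finset.mem_Icc.1 hN
      omega
    · exact le_rfl
  · have h1 : convCoeff r m ≤ convCoeff r r := by
      refine Finset.sum_le_sum fun N hN => ?_
      have := Finset.mem_Icc.1 hN
      rw [if_pos (by omega), if_pos (by omega)]
      refine mul_le_mul_of_nonneg_left ?_ (expCoeff_nonneg (by omega))
      exact binCoeff_antitone (by positivity) (hγ N hN) (by omega)
    rw [convCoeff_self hr] at h1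
    have h2 : 1 / (r : ℝ) * (harm r - 1) ≤ 1 := by
      rw [one_div, inv_mul_le_iff₀ hr0]
      linarith [harm_le r]
    linarith

/-! ### Power series in `w` and the exponent at the saddle. -/

lemma Gamma_add_natCast_eq_prod {s : ℝ} (hs : 0 < s) (k : ℕ) :
    Real.Gamma (s + k) = (∏ i ∈ Finset.range k, (s + i)) * Real.Gamma s := by
  induction k with
  | zero => simp
  | succ k ih =>
    rw [Finset.prod_range_succ, Nat.cast_succ, ← add_assoc, Real.Gamma_add_one (by positivity), ih]
    ring

lemma dCoeff_eq_expCoeff {r N : ℕ} (hN : 1 ≤ N) (hNr : N < r) : dCoeff r N = expCoeff r N := by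
  have hr : (0 : ℝ) < r := by
    have : 0 < r := by omega
    positivity
  have hs : (0 : ℝ) < 1 + (N : ℝ) / r := by positivity
  have h1 : (N : ℝ) + (N : ℝ) / r = 1 + (N : ℝ) / r + ((N - 1 : ℕ) : ℝ) := by
    rw [Nat.cast_sub hN]
    push_cast
    ring
  unfold dCoeff expCoeff
  rw [if_neg (by omega), if_neg (by omega), h1, Gamma_add_natCast_eq_prod hs,
    Real.Gamma_nat_eq_factorial, mul_div_mul_right _ _ (Real.Gamma_pos_of_pos hs).ne']
  congr 1
  exact Finset.prod_congr rfl fun i _ => by ring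

lemma dCoeff_self {r : ℕ} (hr : 2 ≤ r) : dCoeff r r = -(1 / (r : ℝ) * (harm r - 1)) := by
  unfold dCoeff harm
  rw [if_neg (by omega), if_pos rfl]
  obtain ⟨k, rfl⟩ := Nat.exists_eq_add_of_le' (show 1 ≤ r by omega)
  have : ∑ j ∈ Finset.Icc 2 (k + 1), 1 / (j : ℝ) =
      ∑ j ∈ Finset.range k, 1 / (((j + 1 : ℕ) : ℝ) + 1) := by
    refine Finset.sum_bij' (fun j _ => j - 2) (fun j _ => j + 2) ?_ ?_ ?_ ?_ ?_
    · intro j hj; simp only [Finset.mem_Icc, Finset.mem_range] at hj ⊢; omega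
    · intro j hj; simp only [Finset.mem_Icc, Finset.mem_range] at hj ⊢; omega
    · intro j hj; simp only [Finset.mem_Icc] at hj; omega
    · intro j hj; simp
    · intro j hj
      simp only [Finset.mem_Icc] at hj
      congr 1
      norm_cast
      omega
  rw [Finset.sum_range_succ', this]
  push_cast
  ring

lemma choose_eq_binCoeff (γ : ℝ) (k : ℕ) :
    Ring.choose (1 - γ + k - 1) k = binCoeff γ k := by
  have hk : (k ! : ℝ) ≠ 0 := by positivity
  have h := Ring.factorial_nsmul_multichoose_eq_ascPochhammer (1 - γ) k
  have h2 : ∀ n : ℕ, (ascPochhammer ℝ n).eval (1 - γ) = ∏ i ∈ Finset.range n, (1 - γ + i) := by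
    intro n
    induction n with
    | zero => simp
    | succ n ih => rw [ascPochhammer_succ_eval, ih, Finset.prod_range_succ]
  rw [Polynomial.ascPochhammer_smeval_eq_eval, h2, nsmul_eq_mul] at h
  rw [← Ring.multichoose_eq]
  unfold binCoeff
  rw [eq_div_iff hk, mul_comm, h]
  exact Finset.prod_congr rfl fun i _ => by ring

lemma hasSum_binCoeff (γ : ℝ) {w : ℝ} (hw0 : 0 < w) (hw : w < 1) :
    HasSum (fun k => binCoeff γ k * w ^ k) ((1 - w) ^ (γ - 1)) := by
  have h := Real.one_div_one_sub_rpow_hasFPowerSeriesOnBall_zero (1 - γ)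
  have h2 := h.hasSum (y := w) (by
    rw [Metric.mem_eball, edist_zero_right, ← ofReal_norm, Real.norm_of_nonneg hw0.le,
      ENNReal.ofReal_lt_one]
    exact hw)
  simp only [FormalMultilinearSeries.ofScalars_apply_eq, zero_add, smul_eq_mul,
    choose_eq_binCoeff] at h2
  have h3 : 1 / (1 - w) ^ (1 - γ) = (1 - w) ^ (γ - 1) := by
    rw [one_div, ← Real.rpow_neg (by linarith), neg_sub]
  rwa [h3] at h2

/-- Cauchy product of the series for `-log (1 - w)` with the geometric series. -/
lemma hasSum_harm {w : ℝ} (hw0 : 0 < w) (hw : w < 1) :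
    HasSum (fun m => harm m * w ^ m) (-Real.log (1 - w) / (1 - w)) := by
  have h1 : HasSum (fun n : ℕ => w ^ (n + 1) / ((n : ℝ) + 1)) (-Real.log (1 - w)) :=
    Real.hasSum_pow_div_log_of_abs_lt_one (by rwa [abs_of_pos hw0])
  have h2 := hasSum_geometric_of_lt_one hw0.le hw
  have s1 : Summable fun n : ℕ => ‖w ^ (n + 1) / ((n : ℝ) + 1)‖ := by
    refine h1.summable.congr fun n => ?_
    rw [Real.norm_of_nonneg (by positivity)]
  have s2 : Summable fun n : ℕ => ‖w ^ n‖ := by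
    refine h2.summable.congr fun n => ?_
    rw [Real.norm_of_nonneg (by positivity)]
  have h3 := tsum_mul_tsum_eq_tsum_sum_range_of_summable_norm s1 s2
  have s3 := (summable_norm_sum_mul_range_of_summable_norm s1 s2).of_norm
  have h4 := s3.hasSum
  rw [← h3, h1.tsum_eq, h2.tsum_eq, ← div_eq_mul_inv] at h4
  rw [← hasSum_nat_add_iff' 1]
  have h5 : ∀ n : ℕ, ∑ k ∈ Finset.range (n + 1), w ^ (k + 1) / ((k : ℝ) + 1) * w ^ (n - k) =
      harm (n + 1) * w ^ (n + 1) := by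
    intro n
    unfold harm
    rw [Finset.sum_mul]
    refine Finset.sum_congr rfl fun k hk => ?_
    have : n + 1 = (k + 1) + (n - k) := by
      have := Finset.mem_range.1 hk
      omega
    rw [this, pow_add]
    ring
  simp_rw [h5] at h4
  simpa [harm] using h4

/-- The coefficient of `w ^ m` in the expansion error of the exponent, scaled by `w ^ r`. -/
noncomputable def errCoeff (r m : ℕ) : ℝ :=
  1 / (r : ℝ) * harm m - 1 / r + (if m < r then 1 / ((r : ℝ) - m) else 0) - convCoeff r m -
    (if m = r then dCoeff r r else 0)

/-- Below `r` the convolution identity matches the coefficients; at `r` the convolution is twice the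
harmonic term, and `dCoeff r r` corrects exactly the surplus. -/
lemma errCoeff_eq_zero {r m : ℕ} (hr : 2 ≤ r) (hm : m ≤ r) : errCoeff r m = 0 := by
  unfold errCoeff
  rcases hm.lt_or_eq with hm | rfl
  · rw [if_pos hm, if_neg hm.ne, convCoeff_eq_of_lt hm]
    ring
  · rw [if_neg (lt_irrefl _), if_pos rfl, convCoeff_self hr, dCoeff_self hr]
    ring

lemma abs_errCoeff_le {r k : ℕ} (hr : 2 ≤ r) (hk : 1 ≤ k) : |errCoeff r (k + r)| ≤ 2 * k := by
  have hr0 : (0 : ℝ) < r := by positivity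
  unfold errCoeff
  rw [if_neg (by omega), if_neg (by omega)]
  obtain ⟨h1, h2⟩ := convCoeff_bounds hr (m := k + r) (by omega)
  have h3 : 1 ≤ harm (k + r) := one_le_harm (by omega)
  have h4 := harm_le (k + r)
  push_cast at h4
  have hk1 : (1 : ℝ) ≤ k := by exact_mod_cast hk
  have h5 : 1 / (r : ℝ) * harm (k + r) ≤ 1 + k := by
    rw [one_div, inv_mul_le_iff₀ hr0]
    have : (1 : ℝ) ≤ r := by exact_mod_cast (by omega : 1 ≤ r)
    nlinarith
  have h6 : 1 / (r : ℝ) ≤ 1 / (r : ℝ) * harm (k + r) :=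
    le_mul_of_one_le_right (by positivity) h3
  have h7 : 0 < 1 / (r : ℝ) := by positivity
  rw [abs_le]
  constructor <;> linarith

lemma abs_le_of_hasSum_errCoeff {r : ℕ} (hr : 2 ≤ r) {w s : ℝ} (hw0 : 0 < w) (hw : w ≤ 1 / 2)
    (hs : HasSum (fun m => errCoeff r m * w ^ m) s) : |s| ≤ w ^ r * (8 * w) := by
  rw [← hasSum_nat_add_iff' r, Finset.sum_eq_zero, sub_zero] at hs
  · have h1 := (hasSum_coe_mul_geometric_of_norm_lt_one (r := w) (by
      rw [Real.norm_of_nonneg hw0.le]; linarith)).mul_left (2 * w ^ r)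
    -- The series `∑ k w ^ k` equals `w / (1 - w) ^ 2`, which is at most `4 * w` for `w ≤ 1 / 2`.
    have h2 : |s| ≤ 2 * w ^ r * (w / (1 - w) ^ 2) := by
      rw [← hs.tsum_eq, ← h1.tsum_eq, ← Real.norm_eq_abs]
      refine tsum_of_norm_bounded h1.summable.hasSum fun k => ?_
      rw [norm_mul, Real.norm_eq_abs, Real.norm_of_nonneg (by positivity), pow_add]
      have h3 : |errCoeff r (k + r)| ≤ 2 * k := by
        rcases Nat.eq_zero_or_pos k with rfl | hk
        · simp [errCoeff_eq_zero hr]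
        · exact abs_errCoeff_le hr hk
      calc _ ≤ 2 * k * (w ^ k * w ^ r) := mul_le_mul_of_nonneg_right h3 (by positivity)
        _ = _ := by ring
    refine h2.trans ?_
    have h4 : w / (1 - w) ^ 2 ≤ 4 * w := by
      rw [div_le_iff₀ (by nlinarith)]
      nlinarith [mul_nonneg hw0.le (by nlinarith : 0 ≤ 4 * (1 - w) ^ 2 - 1)]
    nlinarith [pow_pos hw0 r]
  · intro m hm
    rw [errCoeff_eq_zero hr (Finset.mem_range.1 hm).le, zero_mul]

lemma hasSum_convCoeff (r : ℕ) {w : ℝ} (hw0 : 0 < w) (hw : w < 1) :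
    HasSum (fun m => convCoeff r m * w ^ m)
      (∑ N ∈ Finset.Icc 1 (r - 1), expCoeff r N * (w ^ N * (1 - w) ^ ((N : ℝ) / r - 1))) := by
  have h1 : ∀ N ∈ Finset.Icc 1 (r - 1), HasSum (fun m =>
      (if N ≤ m then expCoeff r N * binCoeff ((N : ℝ) / r) (m - N) else 0) * w ^ m)
      (expCoeff r N * (w ^ N * (1 - w) ^ ((N : ℝ) / r - 1))) := by
    intro N _
    rw [← hasSum_nat_add_iff' N, Finset.sum_eq_zero, sub_zero]
    · have h := (hasSum_binCoeff ((N : ℝ) / r) hw0 hw).mul_left (expCoeff r N * w ^ N)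
      rw [mul_assoc] at h
      refine h.congr_fun fun k => ?_
      rw [if_pos (Nat.le_add_left N k), Nat.add_sub_cancel, pow_add]
      ring
    · intro m hm
      rw [if_neg (by have := Finset.mem_range.1 hm; omega), zero_mul]
  have h2 := hasSum_sum h1
  refine h2.congr_fun fun m => ?_
  rw [convCoeff, Finset.sum_mul]

lemma hasSum_errCoeff (r : ℕ) {w : ℝ} (hw0 : 0 < w) (hw : w < 1) :
    HasSum (fun m => errCoeff r m * w ^ m)
      (1 / (r : ℝ) * (-Real.log (1 - w) / (1 - w)) - 1 / r * (1 - w)⁻¹ +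
        ∑ m ∈ Finset.range r, w ^ m / ((r : ℝ) - m) -
        ∑ N ∈ Finset.Icc 1 (r - 1), expCoeff r N * (w ^ N * (1 - w) ^ ((N : ℝ) / r - 1)) -
        dCoeff r r * w ^ r) := by
  have h1 := (hasSum_harm hw0 hw).mul_left (1 / (r : ℝ))
  have h2 := (hasSum_geometric_of_lt_one hw0.le hw).mul_left (1 / (r : ℝ))
  have h3 : HasSum (fun m => (if m < r then 1 / ((r : ℝ) - m) else 0) * w ^ m)
      (∑ m ∈ Finset.range r, w ^ m / ((r : ℝ) - m)) := by
    have h : HasSum (fun m => (if m < r then 1 / ((r : ℝ) - m) else 0) * w ^ m)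
        (∑ m ∈ Finset.range r, (if m < r then 1 / ((r : ℝ) - m) else 0) * w ^ m) :=
      hasSum_sum_of_ne_finset_zero fun m hm => by rw [if_neg (by simpa using hm), zero_mul]
    rwa [Finset.sum_congr rfl fun m hm => by
      rw [if_pos (Finset.mem_range.1 hm), one_div_mul_eq_div]] at h
  have h4 := hasSum_convCoeff r hw0 hw
  have h5 : HasSum (fun m => (if m = r then dCoeff r r else 0) * w ^ m) (dCoeff r r * w ^ r) := by
    have := hasSum_single (f := fun m => (if m = r then dCoeff r r else 0) * w ^ m) r
      (fun m hm => by rw [if_neg hm, zero_mul])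
    simpa using this
  have h := (((h1.sub h2).add h3).sub h4).sub h5
  refine h.congr_fun fun m => ?_
  unfold errCoeff
  ring

/-- The expansion of the exponent at the approximate saddle point `x`. -/
lemma exponent_estimate {r : ℕ} (hr : 2 ≤ r) {x n : ℝ} (hx : 2 ≤ x)
    (hn : n * (x - 1) = x ^ (r + 1)) :
    |∑ j ∈ Finset.Icc 1 r, x ^ j / j - n * Real.log x -
      (-(n / r) * Real.log n + n / r + ∑ N ∈ Finset.Icc 1 (r - 1),
        dCoeff r N * n ^ (((r : ℝ) - N) / r) + dCoeff r r)| ≤ 8 / x := by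
  have hr0 : (0 : ℝ) < r := by positivity
  have hx0 : 0 < x := by linarith
  set w := x⁻¹ with hwdef
  have hw0 : 0 < w := by positivity
  have hw2 : w ≤ 1 / 2 := by
    rw [hwdef, one_div]
    exact inv_anti₀ (by norm_num) hx
  have hxw : x * w = 1 := mul_inv_cancel₀ hx0.ne'
  have h1w : 0 < 1 - w := by linarith
  have hnw : n = x ^ r * (1 - w)⁻¹ := by
    rw [eq_mul_inv_iff_mul_eq₀ h1w.ne']
    refine mul_right_cancel₀ hx0.ne' ?_
    rw [← pow_succ, ← hn]
    linear_combination (-n) * hxw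
  have hn0 : 0 < n := by
    rw [hnw]
    positivity
  have hlog : Real.log n = r * Real.log x - Real.log (1 - w) := by
    rw [hnw, Real.log_mul (by positivity) (by positivity), Real.log_pow, Real.log_inv]
    ring
  have hxr : x ^ r * w ^ r = 1 := by rw [← mul_pow, hxw, one_pow]
  have key := abs_le_of_hasSum_errCoeff hr hw0 hw2 (hasSum_errCoeff r hw0 (by linarith))
  set s := 1 / (r : ℝ) * (-Real.log (1 - w) / (1 - w)) - 1 / r * (1 - w)⁻¹ +
        ∑ m ∈ Finset.range r, w ^ m / ((r : ℝ) - m) -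
        ∑ N ∈ Finset.Icc 1 (r - 1), expCoeff r N * (w ^ N * (1 - w) ^ ((N : ℝ) / r - 1)) -
        dCoeff r r * w ^ r with hs
  have hP : x ^ r * ∑ m ∈ Finset.range r, w ^ m / ((r : ℝ) - m) =
      ∑ j ∈ Finset.Icc 1 r, x ^ j / j := by
    rw [Finset.mul_sum]
    refine Finset.sum_bij' (fun m _ => r - m) (fun j _ => r - j) ?_ ?_ ?_ ?_ ?_
    · intro m hm; simp only [Finset.mem_range, Finset.mem_Icc] at hm ⊢; omega
    · intro m hm; simp only [Finset.mem_range, Finset.mem_Icc] at hm ⊢; omega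
    · intro m hm; simp only [Finset.mem_range] at hm; omega
    · intro m hm; simp only [Finset.mem_Icc] at hm; omega
    · intro m hm
      have hmr := (Finset.mem_range.1 hm).le
      have h1 : x ^ r = x ^ (r - m) * x ^ m := by rw [← pow_add, Nat.sub_add_cancel hmr]
      have h2 : x ^ m * w ^ m = 1 := by rw [← mul_pow, hxw, one_pow]
      rw [Nat.cast_sub hmr, h1]
      rw [mul_assoc, ← mul_div_assoc, h2, mul_one_div]
  have hS : x ^ r * ∑ N ∈ Finset.Icc 1 (r - 1),
      expCoeff r N * (w ^ N * (1 - w) ^ ((N : ℝ) / r - 1)) =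
      ∑ N ∈ Finset.Icc 1 (r - 1), dCoeff r N * n ^ (((r : ℝ) - N) / r) := by
    rw [Finset.mul_sum]
    refine Finset.sum_congr rfl fun N hN => ?_
    have hN' := Finset.mem_Icc.1 hN
    have hNr : N ≤ r := by omega
    rw [dCoeff_eq_expCoeff hN'.1 (by omega)]
    have h1 : x ^ r = x ^ (r - N) * x ^ N := by rw [← pow_add, Nat.sub_add_cancel hNr]
    have h2 : x ^ N * w ^ N = 1 := by rw [← mul_pow, hxw, one_pow]
    -- The choice of saddle pays off here: fractional powers of `n` are integral powers of `x` times
    -- binomial series in `w`.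
    have h3 : n ^ (((r : ℝ) - N) / r) = x ^ (r - N) * (1 - w) ^ ((N : ℝ) / r - 1) := by
      rw [hnw, Real.mul_rpow (by positivity) (by positivity), ← Real.rpow_natCast x r,
        ← Real.rpow_mul hx0.le, mul_div_cancel₀ _ hr0.ne', ← Nat.cast_sub hNr, Real.rpow_natCast,
        Real.inv_rpow h1w.le, ← Real.rpow_neg h1w.le, Nat.cast_sub hNr]
      congr 2
      field_simp
      ring
    rw [h3, h1]
    linear_combination (expCoeff r N * x ^ (r - N) * (1 - w) ^ ((N : ℝ) / r - 1)) * h2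
  have hmain : x ^ r * s = ∑ j ∈ Finset.Icc 1 r, x ^ j / j - n * Real.log x -
      (-(n / r) * Real.log n + n / r + ∑ N ∈ Finset.Icc 1 (r - 1),
        dCoeff r N * n ^ (((r : ℝ) - N) / r) + dCoeff r r) := by
    rw [hs, mul_sub, mul_sub, mul_add, mul_sub, hP, hS, hlog]
    have h1 : x ^ r * (1 / (r : ℝ) * (-Real.log (1 - w) / (1 - w))) =
        -(n / r) * Real.log (1 - w) := by
      rw [hnw]
      ring
    have h2 : x ^ r * (1 / (r : ℝ) * (1 - w)⁻¹) = n / r := by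
      rw [hnw]
      ring
    have h3 : n / r * (r * Real.log x) = n * Real.log x := by
      field_simp
    rw [h1, h2]
    linear_combination (-dCoeff r r) * hxr - h3
  rw [← hmain, abs_mul, abs_of_pos (by positivity : 0 < x ^ r)]
  calc x ^ r * |s| ≤ x ^ r * (w ^ r * (8 * w)) := mul_le_mul_of_nonneg_left key (by positivity)
    _ = (x ^ r * w ^ r) * (8 * w) := by ring
    _ = 8 / x := by rw [hxr, one_mul, hwdef, div_eq_mul_inv]

/-! ### Gaussian approximation of the integral. -/

lemma norm_exp_sub_exp_le {a b : ℂ} {c : ℝ} (ha : a.re ≤ c) (hb : b.re ≤ c) :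
    ‖Complex.exp a - Complex.exp b‖ ≤ Real.exp c * ‖a - b‖ := by
  refine (convex_halfSpace_re_le c).norm_image_sub_le_of_norm_deriv_le
    (fun z _ => Complex.differentiableAt_exp) (fun z hz => ?_) hb ha
  rw [Complex.deriv_exp, Complex.norm_exp]
  exact Real.exp_le_exp.2 hz

lemma norm_exp_I_taylor_le (y : ℝ) :
    ‖Complex.exp (y * Complex.I) - 1 - y * Complex.I + (y : ℂ) ^ 2 / 2‖ ≤ 5 * |y| ^ 3 := by
  have hy : ‖(y : ℂ) * Complex.I‖ = |y| := by simp
  rcases le_or_gt |y| 1 with h | h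
  · have h1 := Complex.exp_bound (x := y * Complex.I) (by rwa [hy]) (n := 3) (by norm_num)
    rw [hy] at h1
    have h2 : Complex.exp (y * Complex.I) - 1 - y * Complex.I + (y : ℂ) ^ 2 / 2 =
        Complex.exp (y * Complex.I) -
          ∑ m ∈ Finset.range 3, ((y : ℂ) * Complex.I) ^ m / (m ! : ℂ) := by
      simp only [Finset.sum_range_succ, Finset.sum_range_zero, mul_pow, Complex.I_sq,
        Nat.factorial]
      push_cast
      ring
    rw [h2]
    refine h1.trans ?_
    have h3 : 0 ≤ |y| ^ 3 := by positivity
    norm_num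
    linarith
  · have h1 : ‖Complex.exp (y * Complex.I)‖ = 1 := Complex.norm_exp_ofReal_mul_I y
    have h2 : ‖(y : ℂ) ^ 2 / 2‖ = |y| ^ 2 / 2 := by simp
    calc _ ≤ ‖Complex.exp (y * Complex.I)‖ + ‖(1 : ℂ)‖ + ‖(y : ℂ) * Complex.I‖ +
          ‖(y : ℂ) ^ 2 / 2‖ := by
          refine (norm_add_le _ _).trans (add_le_add_left ?_ _)
          refine (norm_sub_le _ _).trans (add_le_add_left ?_ _)
          exact norm_sub_le _ _
      _ ≤ 5 * |y| ^ 3 := by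
          rw [h1, h2, hy, norm_one]
          have h3 : |y| ≤ |y| ^ 3 := by nlinarith [sq_nonneg (|y| - 1)]
          have h4 : |y| ^ 2 ≤ |y| ^ 3 := by nlinarith [sq_nonneg |y|]
          linarith

/-- Since `1 - cos u = |1 - e ^ (i u)| ^ 2 / 2`, this is the triangle inequality followed by `(a +
b) ^ 2 ≤ 2 * (a ^ 2 + b ^ 2)`. -/
lemma one_sub_cos_sub_le (u v : ℝ) :
    1 - Real.cos (u - v) ≤ 2 * ((1 - Real.cos u) + (1 - Real.cos v)) := by
  rw [Real.cos_sub]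
  nlinarith [sq_nonneg (Real.cos u + Real.cos v - 2), sq_nonneg (Real.sin u + Real.sin v),
    Real.sin_sq_add_cos_sq u, Real.sin_sq_add_cos_sq v]

/-- The logarithm of the integrand of Cauchy's formula on the circle of radius `x`, normalized to
vanish at angle `0`. -/
noncomputable def phase (n r : ℕ) (x θ : ℝ) : ℂ :=
  (∑ j ∈ Finset.Icc 1 r, ((x ^ j / j : ℝ) : ℂ) *
    (Complex.exp (((j * θ : ℝ) : ℂ) * Complex.I) - 1)) - ((n * θ : ℝ) : ℂ) * Complex.I

lemma continuous_phase (n r : ℕ) (x : ℝ) : Continuous (phase n r x) := by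
  unfold phase
  fun_prop

lemma phase_re (n r : ℕ) (x θ : ℝ) :
    (phase n r x θ).re = -∑ j ∈ Finset.Icc 1 r, x ^ j / j * (1 - Real.cos (j * θ)) := by
  unfold phase
  rw [Complex.sub_re, Complex.re_sum, ← Finset.sum_neg_distrib]
  have h1 : (((n * θ : ℝ) : ℂ) * Complex.I).re = 0 := by
    rw [Complex.re_ofReal_mul, Complex.I_re, mul_zero]
  rw [h1, sub_zero]
  refine Finset.sum_congr rfl fun j _ => ?_
  rw [Complex.re_ofReal_mul, Complex.sub_re, Complex.exp_ofReal_mul_I_re, Complex.one_re]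
  ring

section Saddle

variable {n r : ℕ} {x : ℝ}

lemma sum_pow_mul_sub_one (r : ℕ) (x : ℝ) :
    (∑ j ∈ Finset.Icc 1 r, x ^ j) * (x - 1) = x ^ (r + 1) - x := by
  induction r with
  | zero => simp
  | succ r ih =>
    rw [Finset.sum_Icc_succ_top (by omega), add_mul, ih]
    ring

lemma pow_le_of_saddle (hx : 2 ≤ x) (hn : (n : ℝ) * (x - 1) = x ^ (r + 1)) : x ^ r ≤ n := by
  have h : x ^ r * x = n * (x - 1) := by rw [hn, pow_succ]
  have hn0 : (0 : ℝ) ≤ n := Nat.cast_nonneg n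
  by_contra hlt
  push Not at hlt
  nlinarith

lemma half_le_pow_of_saddle (hx : 2 ≤ x) (hn : (n : ℝ) * (x - 1) = x ^ (r + 1)) :
    (n : ℝ) / 2 ≤ x ^ r := by
  have h : x ^ r * x = n * (x - 1) := by rw [hn, pow_succ]
  have hn0 : (0 : ℝ) ≤ n := Nat.cast_nonneg n
  by_contra hlt
  push Not at hlt
  nlinarith

lemma natCast_le_two_pow_pred {r : ℕ} (hr : 2 ≤ r) : (r : ℝ) ≤ 2 ^ (r - 1) := by
  obtain ⟨k, rfl⟩ := Nat.exists_eq_add_of_le' (show 1 ≤ r by omega)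
  rw [Nat.add_sub_cancel]
  exact_mod_cast Nat.lt_two_pow_self

lemma mul_natCast_le_of_saddle (hr : 2 ≤ r) (hx : 2 ≤ x)
    (hn : (n : ℝ) * (x - 1) = x ^ (r + 1)) : x * r ≤ n := by
  refine le_trans ?_ (pow_le_of_saddle hx hn)
  have h1 : x ^ r = x * x ^ (r - 1) := by
    rw [← pow_succ', Nat.sub_add_cancel (by omega)]
  rw [h1]
  refine mul_le_mul_of_nonneg_left ((natCast_le_two_pow_pred hr).trans ?_) (by linarith)
  exact pow_le_pow_left₀ (by norm_num) hx _

/-- Equivalent to `r / √(r n) ≤ √2 / x`, the scale of the cubic term of the phase at the Gaussian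
width; this gives the final error `1 / x`. -/
lemma sq_mul_natCast_le_of_saddle (hr : 2 ≤ r) (hx : 2 ≤ x)
    (hn : (n : ℝ) * (x - 1) = x ^ (r + 1)) : x ^ 2 * r ≤ 2 * n := by
  have h0 := pow_le_of_saddle hx hn
  have h1 : x ^ r = x ^ 2 * x ^ (r - 2) := by
    rw [← pow_add, Nat.add_sub_cancel' hr]
  have h2 : (r : ℝ) ≤ 2 * 2 ^ (r - 2) := by
    refine (natCast_le_two_pow_pred hr).trans_eq ?_
    rw [← pow_succ']
    congr 1
    omega
  have h3 : (2 : ℝ) ^ (r - 2) ≤ x ^ (r - 2) := pow_le_pow_left₀ (by norm_num) hx _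
  have h4 : 0 ≤ x ^ 2 := sq_nonneg x
  nlinarith

lemma sum_sub_mul_pow_le (r : ℕ) {x : ℝ} (hx : 2 ≤ x) :
    x * ∑ j ∈ Finset.Icc 1 r, ((r : ℝ) - j) * x ^ j ≤ 4 * x ^ r := by
  induction r with
  | zero => simp
  | succ r ih =>
    have h1 : ∑ j ∈ Finset.Icc 1 (r + 1), (((r + 1 : ℕ) : ℝ) - j) * x ^ j =
        ∑ j ∈ Finset.Icc 1 r, ((r : ℝ) - j) * x ^ j + ∑ j ∈ Finset.Icc 1 r, x ^ j := by
      rw [Finset.sum_Icc_succ_top (by omega), sub_self, zero_mul, add_zero,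
        ← Finset.sum_add_distrib]
      refine Finset.sum_congr rfl fun j _ => ?_
      push_cast
      ring
    have h2 := sum_pow_mul_sub_one r x
    have h3 : ∑ j ∈ Finset.Icc 1 r, x ^ j ≤ 2 * x ^ r := by
      have h4 : 0 < x ^ r := pow_pos (by linarith) r
      rw [pow_succ] at h2
      by_contra hlt
      push Not at hlt
      nlinarith
    have h4 : 0 < x ^ r := pow_pos (by linarith) r
    rw [h1, mul_add, pow_succ]
    nlinarith

/-- The three errors are the linear term `n - ∑ x ^ j = x / (x - 1) ≤ 2`, the defect of the variance
`∑ j * x ^ j` from `r * n`, and the cubic Taylor remainder. -/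
lemma phase_quadratic_le (hr : 2 ≤ r) (hx : 2 ≤ x) (hn : (n : ℝ) * (x - 1) = x ^ (r + 1)) (θ : ℝ) :
    ‖phase n r x θ - ((-(r * n / 2 * θ ^ 2) : ℝ) : ℂ)‖ ≤
      2 * |θ| + 3 * (n / x) * |θ| ^ 2 + 5 * (r ^ 2 * n) * |θ| ^ 3 := by
  have hx0 : 0 < x := by linarith
  have hn0 : (0 : ℝ) ≤ n := Nat.cast_nonneg n
  set S := ∑ j ∈ Finset.Icc 1 r, x ^ j with hS
  set V := ∑ j ∈ Finset.Icc 1 r, (j : ℝ) * x ^ j with hV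
  have hS1 : (n - S) * (x - 1) = x := by
    have := sum_pow_mul_sub_one r x
    rw [sub_mul, hn, hS, this]
    ring
  have hS2 : 0 ≤ n - S := by
    by_contra hlt
    push Not at hlt
    nlinarith
  have hS3 : n - S ≤ 2 := by
    by_contra hlt
    push Not at hlt
    nlinarith
  have hT : r * S - V = ∑ j ∈ Finset.Icc 1 r, ((r : ℝ) - j) * x ^ j := by
    rw [hS, hV, Finset.mul_sum, ← Finset.sum_sub_distrib]
    exact Finset.sum_congr rfl fun j _ => by ring
  have hT0 : 0 ≤ r * S - V := by
    rw [hT]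
    refine Finset.sum_nonneg fun j hj => mul_nonneg ?_ (by positivity)
    have : (j : ℝ) ≤ r := by exact_mod_cast (Finset.mem_Icc.1 hj).2
    linarith
  have hT1 : x * (r * S - V) ≤ 4 * n := by
    rw [hT]
    exact (sum_sub_mul_pow_le r hx).trans (by linarith [pow_le_of_saddle hx hn])
  have hr0 : (0 : ℝ) ≤ r := Nat.cast_nonneg r
  have hV0 : 0 ≤ r * n - V := by nlinarith
  have hV1 : r * n - V ≤ 6 * (n / x) := by
    rw [← mul_div_assoc, le_div_iff₀ hx0]
    have := mul_natCast_le_of_saddle hr hx hn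
    nlinarith [mul_nonneg hx0.le hr0]
  have key : phase n r x θ - ((-(r * n / 2 * θ ^ 2) : ℝ) : ℂ) =
      (∑ j ∈ Finset.Icc 1 r, ((x ^ j / j : ℝ) : ℂ) *
        (Complex.exp (((j * θ : ℝ) : ℂ) * Complex.I) - 1 - ((j * θ : ℝ) : ℂ) * Complex.I +
          ((j * θ : ℝ) : ℂ) ^ 2 / 2)) + ((-((n - S) * θ) : ℝ) : ℂ) * Complex.I +
          (((r * n - V) / 2 * θ ^ 2 : ℝ) : ℂ) := by
    have e1 : ∑ j ∈ Finset.Icc 1 r, ((x ^ j / j : ℝ) : ℂ) *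
        (Complex.exp (((j * θ : ℝ) : ℂ) * Complex.I) - 1 - ((j * θ : ℝ) : ℂ) * Complex.I +
          ((j * θ : ℝ) : ℂ) ^ 2 / 2) =
        (∑ j ∈ Finset.Icc 1 r, ((x ^ j / j : ℝ) : ℂ) *
          (Complex.exp (((j * θ : ℝ) : ℂ) * Complex.I) - 1)) - ((S * θ : ℝ) : ℂ) * Complex.I +
          ((V / 2 * θ ^ 2 : ℝ) : ℂ) := by
      rw [hS, hV, Finset.sum_mul, Finset.sum_div, Finset.sum_mul, Complex.ofReal_sum,
        Complex.ofReal_sum, Finset.sum_mul, ← Finset.sum_sub_distrib, ← Finset.sum_add_distrib]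
      refine Finset.sum_congr rfl fun j hj => ?_
      have hj0 : (j : ℂ) ≠ 0 := by
        have := (Finset.mem_Icc.1 hj).1
        exact Nat.cast_ne_zero.2 (by omega)
      push_cast
      field_simp
    rw [e1]
    unfold phase
    push_cast
    ring
  have hsum : ‖∑ j ∈ Finset.Icc 1 r, ((x ^ j / j : ℝ) : ℂ) *
        (Complex.exp (((j * θ : ℝ) : ℂ) * Complex.I) - 1 - ((j * θ : ℝ) : ℂ) * Complex.I +
          ((j * θ : ℝ) : ℂ) ^ 2 / 2)‖ ≤ 5 * (r ^ 2 * n) * |θ| ^ 3 := by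
    have h1 : ∀ j ∈ Finset.Icc 1 r, ‖((x ^ j / j : ℝ) : ℂ) *
        (Complex.exp (((j * θ : ℝ) : ℂ) * Complex.I) - 1 - ((j * θ : ℝ) : ℂ) * Complex.I +
          ((j * θ : ℝ) : ℂ) ^ 2 / 2)‖ ≤ (5 * r ^ 2 * |θ| ^ 3) * x ^ j := by
      intro j hj
      obtain ⟨hj1, hj2⟩ := Finset.mem_Icc.1 hj
      have hj0 : (0 : ℝ) < j := by positivity
      have hjr : (j : ℝ) ≤ r := by exact_mod_cast hj2
      rw [norm_mul, Complex.norm_real, Real.norm_of_nonneg (by positivity)]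
      calc _ ≤ x ^ j / j * (5 * |j * θ| ^ 3) :=
            mul_le_mul_of_nonneg_left (norm_exp_I_taylor_le _) (by positivity)
        _ = (5 * (j : ℝ) ^ 2 * |θ| ^ 3) * x ^ j := by
            rw [abs_mul, abs_of_pos hj0]
            field_simp
        _ ≤ _ := by gcongr
    refine (norm_sum_le_of_le _ h1).trans ?_
    rw [← Finset.mul_sum, ← hS]
    have h2 : S ≤ n := by linarith
    calc 5 * (r : ℝ) ^ 2 * |θ| ^ 3 * S ≤ 5 * (r : ℝ) ^ 2 * |θ| ^ 3 * n :=
          mul_le_mul_of_nonneg_left h2 (by positivity)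
      _ = _ := by ring
  have hlin : ‖((-((n - S) * θ) : ℝ) : ℂ) * Complex.I‖ ≤ 2 * |θ| := by
    rw [norm_mul, Complex.norm_I, mul_one, Complex.norm_real, Real.norm_eq_abs, abs_neg, abs_mul,
      abs_of_nonneg hS2]
    exact mul_le_mul_of_nonneg_right hS3 (abs_nonneg _)
  have hquad : ‖(((r * n - V) / 2 * θ ^ 2 : ℝ) : ℂ)‖ ≤ 3 * (n / x) * |θ| ^ 2 := by
    rw [Complex.norm_real, Real.norm_of_nonneg (by positivity), sq_abs]
    exact mul_le_mul_of_nonneg_right (by linarith) (sq_nonneg _)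
  rw [key]
  calc _ ≤ 5 * (r ^ 2 * n) * |θ| ^ 3 + 2 * |θ| + 3 * (n / x) * |θ| ^ 2 :=
        (norm_add₃_le).trans (add_le_add (add_le_add hsum hlin) hquad)
    _ = _ := by ring

lemma phase_term_nonneg (hx : 2 ≤ x) (θ : ℝ) (j : ℕ) :
    0 ≤ x ^ j / j * (1 - Real.cos (j * θ)) :=
  mul_nonneg (div_nonneg (pow_nonneg (by linarith) _) (Nat.cast_nonneg j))
    (by linarith [Real.cos_le_one (j * θ)])

lemma two_div_pi_sq_mul_sq_le_one_sub_cos {y : ℝ} (hy : |y| ≤ Real.pi) :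
    2 / Real.pi ^ 2 * y ^ 2 ≤ 1 - Real.cos y := by
  have := Real.cos_le_one_sub_mul_cos_sq hy
  linarith

/-- The single term `j = r` suffices, since `x ^ r ≥ n / 2` and `2 / π ^ 2 ≥ 1 / 5`; these give the
constant 10. -/
lemma phase_re_central (hr : 2 ≤ r) (hx : 2 ≤ x) (hn : (n : ℝ) * (x - 1) = x ^ (r + 1)) {θ : ℝ}
    (hθ : |θ| ≤ Real.pi / r) : (phase n r x θ).re ≤ -(r * n / 10 * θ ^ 2) := by
  have hr0 : (0 : ℝ) < r := by positivity
  rw [phase_re, neg_le_neg_iff]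
  have h1 : x ^ r / r * (1 - Real.cos (r * θ)) ≤
      ∑ j ∈ Finset.Icc 1 r, x ^ j / j * (1 - Real.cos (j * θ)) :=
    Finset.single_le_sum (f := fun j : ℕ => x ^ j / j * (1 - Real.cos (j * θ)))
      (fun j _ => phase_term_nonneg hx θ j) (Finset.mem_Icc.2 ⟨by omega, le_rfl⟩)
  refine le_trans ?_ h1
  have h2 : 2 / Real.pi ^ 2 * (r * θ) ^ 2 ≤ 1 - Real.cos (r * θ) := by
    refine two_div_pi_sq_mul_sq_le_one_sub_cos ?_
    rw [abs_mul, abs_of_pos hr0]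
    rw [le_div_iff₀ hr0] at hθ
    linarith
  have h3 : (1 : ℝ) / 5 ≤ 2 / Real.pi ^ 2 := by
    rw [div_le_div_iff₀ (by norm_num) (by positivity)]
    nlinarith [Real.pi_lt_d2, Real.pi_pos]
  have h4 := half_le_pow_of_saddle hx hn
  calc r * n / 10 * θ ^ 2 = (n / 2) / r * (1 / 5 * (r * θ) ^ 2) := by field_simp; ring
    _ ≤ x ^ r / r * (2 / Real.pi ^ 2 * (r * θ) ^ 2) := by gcongr
    _ ≤ _ := by gcongr

/-- The angles `r θ` and `(r - 1) θ` differ by `θ`, so they cannot both be close to multiples of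
`2π` when `π / r < |θ| ≤ π`. -/
lemma phase_re_outer (hr : 2 ≤ r) (hx : 2 ≤ x) {θ : ℝ}
    (hθ : Real.pi / r < |θ|) (hθ' : |θ| ≤ Real.pi) :
    (phase n r x θ).re ≤ -(x ^ (r - 1) / r ^ 3) := by
  have hr0 : (0 : ℝ) < r := by positivity
  have hx0 : 0 < x := by linarith
  rw [phase_re, neg_le_neg_iff]
  have h1 : x ^ (r - 1) / (r - 1 : ℕ) * (1 - Real.cos ((r - 1 : ℕ) * θ)) +
      x ^ r / r * (1 - Real.cos (r * θ)) ≤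
      ∑ j ∈ Finset.Icc 1 r, x ^ j / j * (1 - Real.cos (j * θ)) := by
    rw [← Finset.sum_pair (f := fun j : ℕ => x ^ j / j * (1 - Real.cos (j * θ)))
      (show r - 1 ≠ r by omega)]
    refine Finset.sum_le_sum_of_subset_of_nonneg ?_ fun j _ _ => phase_term_nonneg hx θ j
    intro j hj
    rw [Finset.mem_insert, Finset.mem_singleton] at hj
    rw [Finset.mem_Icc]
    omega
  refine le_trans ?_ h1
  have hr1 : (0 : ℝ) < (r - 1 : ℕ) := by
    have : 0 < r - 1 := by omega
    exact_mod_cast this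
  have hr2 : ((r - 1 : ℕ) : ℝ) ≤ r := by exact_mod_cast Nat.sub_le r 1
  have h2 : x ^ (r - 1) ≤ x ^ r := pow_le_pow_right₀ (by linarith) (Nat.sub_le r 1)
  have hc1 : 0 ≤ 1 - Real.cos ((r - 1 : ℕ) * θ) := by linarith [Real.cos_le_one ((r - 1 : ℕ) * θ)]
  have hc2 : 0 ≤ 1 - Real.cos (r * θ) := by linarith [Real.cos_le_one (r * θ)]
  have h3 := one_sub_cos_sub_le (r * θ) ((r - 1 : ℕ) * θ)
  have h4 : (r : ℝ) * θ - (r - 1 : ℕ) * θ = θ := by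
    rw [Nat.cast_sub (by omega)]
    push_cast
    ring
  rw [h4] at h3
  have h5 := two_div_pi_sq_mul_sq_le_one_sub_cos hθ'
  have h6 : 2 / (r : ℝ) ^ 2 ≤ 2 / Real.pi ^ 2 * θ ^ 2 := by
    rw [← sq_abs θ]
    calc 2 / (r : ℝ) ^ 2 = 2 / Real.pi ^ 2 * (Real.pi / r) ^ 2 := by
          field_simp
      _ ≤ _ := by gcongr
  have h7 : 1 / (r : ℝ) ^ 2 ≤ (1 - Real.cos ((r - 1 : ℕ) * θ)) + (1 - Real.cos (r * θ)) := by
    have : 2 / (r : ℝ) ^ 2 = 2 * (1 / (r : ℝ) ^ 2) := by ring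
    linarith
  calc x ^ (r - 1) / (r : ℝ) ^ 3 = x ^ (r - 1) / r * (1 / (r : ℝ) ^ 2) := by
        field_simp
    _ ≤ x ^ (r - 1) / r * ((1 - Real.cos ((r - 1 : ℕ) * θ)) + (1 - Real.cos (r * θ))) := by
        gcongr
    _ = x ^ (r - 1) / r * (1 - Real.cos ((r - 1 : ℕ) * θ)) +
        x ^ (r - 1) / r * (1 - Real.cos (r * θ)) := by ring
    _ ≤ _ := by gcongr

end Saddle

lemma mul_exp_neg_half_sq_le (s : ℝ) :
    s * Real.exp (-(s ^ 2 / 2)) ≤ 1 ∧ s ^ 2 * Real.exp (-(s ^ 2 / 2)) ≤ 1 ∧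
      s ^ 3 * Real.exp (-(s ^ 2 / 2)) ≤ 2 := by
  have h := Real.quadratic_le_exp_of_nonneg (x := s ^ 2 / 2) (by positivity)
  rw [Real.exp_neg]
  have hpos := Real.exp_pos (s ^ 2 / 2)
  refine ⟨?_, ?_, ?_⟩
  · rw [← div_eq_mul_inv, div_le_one hpos]
    nlinarith [sq_nonneg (s - 1), sq_nonneg (s ^ 2)]
  · rw [← div_eq_mul_inv, div_le_one hpos]
    nlinarith [sq_nonneg (s ^ 2 - 2)]
  · rw [← div_eq_mul_inv, div_le_iff₀ hpos]
    nlinarith [mul_nonneg (sq_nonneg s) (sq_nonneg (s - 2))]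

section Saddle

variable {n r : ℕ} {x : ℝ}

/-- Write the Gaussian as `E * E`: one factor absorbs the polynomial, the other remains integrable.
The second bound handles the Gaussian itself where `r * |θ| ≥ 1`. -/
lemma gaussian_weight_le (hr : 2 ≤ r) (hx : 2 ≤ x) (hn : (n : ℝ) * (x - 1) = x ^ (r + 1)) (θ : ℝ) :
    (2 * |θ| + 3 * (n / x) * |θ| ^ 2 + 5 * (r ^ 2 * n) * |θ| ^ 3) *
        Real.exp (-(r * n / 10 * θ ^ 2)) ≤ 520 / x * Real.exp (-(r * n / 20) * θ ^ 2) ∧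
      r * |θ| * Real.exp (-(r * n / 10 * θ ^ 2)) ≤ 520 / x * Real.exp (-(r * n / 20) * θ ^ 2) := by
  have hx0 : 0 < x := by linarith
  have hr2 : (2 : ℝ) ≤ r := by exact_mod_cast hr
  have hn0 : (0 : ℝ) < n := lt_of_lt_of_le (by positivity) (pow_le_of_saddle hx hn)
  set a := √(r * n / 10) with ha
  have ha0 : 0 < a := Real.sqrt_pos.2 (by positivity)
  have ha2 : a ^ 2 = r * n / 10 := Real.sq_sqrt (by positivity)
  set E := Real.exp (-(r * n / 20) * θ ^ 2) with hE
  have hE0 : 0 < E := Real.exp_pos _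
  have hEE : Real.exp (-(r * n / 10 * θ ^ 2)) = E * E := by
    rw [hE, ← Real.exp_add]
    congr 1
    ring
  have hEs : E = Real.exp (-((a * |θ|) ^ 2 / 2)) := by
    rw [hE, mul_pow, sq_abs, ha2]
    congr 1
    ring
  obtain ⟨h1, h2, h3⟩ := mul_exp_neg_half_sq_le (a * |θ|)
  rw [← hEs] at h1 h2 h3
  have hra : r / a ≤ 5 / x := by
    rw [div_le_div_iff₀ ha0 hx0]
    refine (sq_le_sq₀ (by positivity) (by positivity)).1 ?_
    have h := mul_le_mul_of_nonneg_left (sq_mul_natCast_le_of_saddle hr hx hn)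
      (by positivity : (0 : ℝ) ≤ r)
    have hrn : (0 : ℝ) ≤ r * n := by positivity
    rw [mul_pow, mul_pow, ha2]
    nlinarith
  have b1 : |θ| * E ≤ 1 / a := by
    rw [le_div_iff₀ ha0]
    linarith
  have b2 : |θ| ^ 2 * E ≤ 1 / a ^ 2 := by
    rw [le_div_iff₀ (by positivity)]
    linarith
  have b3 : |θ| ^ 3 * E ≤ 2 / a ^ 3 := by
    rw [le_div_iff₀ (by positivity)]
    linarith
  have c1 : 2 * (1 / a) ≤ 5 / x := by
    refine le_trans ?_ hra
    rw [← mul_div_assoc, mul_one]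
    gcongr
  have c2 : 3 * (n / x) * (1 / a ^ 2) ≤ 15 / x := by
    rw [ha2]
    have : 3 * ((n : ℝ) / x) * (1 / (r * n / 10)) = 30 / r / x := by
      field_simp
      norm_num
    rw [this]
    gcongr
    rw [div_le_iff₀ (by positivity)]
    linarith
  have c3 : 5 * ((r : ℝ) ^ 2 * n) * (2 / a ^ 3) ≤ 500 / x := by
    have : 5 * ((r : ℝ) ^ 2 * n) * (2 / a ^ 3) = 100 * (r / a) := by
      have e : (r : ℝ) * n = 10 * a ^ 2 := by rw [ha2]; ring
      field_simp
      linear_combination (10 : ℝ) * e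
    rw [this]
    calc 100 * (r / a) ≤ 100 * (5 / x) := by gcongr
      _ = 500 / x := by ring
  rw [hEE]
  constructor
  · rw [← mul_assoc]
    refine mul_le_mul_of_nonneg_right ?_ hE0.le
    calc _ = 2 * (|θ| * E) + 3 * (n / x) * (|θ| ^ 2 * E) + 5 * (r ^ 2 * n) * (|θ| ^ 3 * E) := by
          ring
      _ ≤ 2 * (1 / a) + 3 * (n / x) * (1 / a ^ 2) + 5 * (r ^ 2 * n) * (2 / a ^ 3) := by gcongr
      _ ≤ 5 / x + 15 / x + 500 / x := add_le_add (add_le_add c1 c2) c3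
      _ = 520 / x := by ring
  · rw [← mul_assoc]
    refine mul_le_mul_of_nonneg_right ?_ hE0.le
    calc r * |θ| * E = r * (|θ| * E) := by ring
      _ ≤ r * (1 / a) := by gcongr
      _ = r / a := by ring
      _ ≤ 5 / x := hra
      _ ≤ 520 / x := by gcongr; norm_num

lemma norm_indicator_sub_gaussian_le (hr : 2 ≤ r) (hx : 2 ≤ x)
    (hn : (n : ℝ) * (x - 1) = x ^ (r + 1)) (θ : ℝ) :
    ‖(Set.Ioc (-Real.pi) Real.pi).indicator (fun θ => Complex.exp (phase n r x θ)) θ -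
        ((Real.exp (-(r * n / 2) * θ ^ 2) : ℝ) : ℂ)‖ ≤
      520 / x * Real.exp (-(r * n / 20) * θ ^ 2) +
        (Set.Ioc (-Real.pi) Real.pi).indicator
          (fun _ => Real.exp (-(x ^ (r - 1) / r ^ 3))) θ := by
  have hr0 : (0 : ℝ) < r := by positivity
  have hx0 : 0 < x := by linarith
  have hr1 : (1 : ℝ) ≤ r := by exact_mod_cast (by omega : 1 ≤ r)
  have hn0 : (0 : ℝ) ≤ n := Nat.cast_nonneg n
  obtain ⟨g1, g2⟩ := gaussian_weight_le hr hx hn θ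
  have hM : ∀ t, 0 ≤ (Set.Ioc (-Real.pi) Real.pi).indicator
      (fun _ : ℝ => Real.exp (-(x ^ (r - 1) / r ^ 3))) t :=
    Set.indicator_nonneg fun _ _ => (Real.exp_pos _).le
  have hq : 0 ≤ r * n * θ ^ 2 := by positivity
  rcases le_or_gt |θ| (Real.pi / r) with h | h
  · have hcen : ‖Complex.exp (phase n r x θ) - ((Real.exp (-(r * n / 2) * θ ^ 2) : ℝ) : ℂ)‖ ≤
        520 / x * Real.exp (-(r * n / 20) * θ ^ 2) := by
      refine le_trans ?_ g1
      have h2 : ((Real.exp (-(r * n / 2) * θ ^ 2) : ℝ) : ℂ) =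
          Complex.exp ((-(r * n / 2 * θ ^ 2) : ℝ) : ℂ) := by
        rw [← Complex.ofReal_exp, neg_mul]
      rw [h2, mul_comm _ (Real.exp (-(r * n / 10 * θ ^ 2)))]
      refine (norm_exp_sub_exp_le (phase_re_central hr hx hn h) ?_).trans ?_
      · rw [Complex.ofReal_re]
        linarith
      · exact mul_le_mul_of_nonneg_left (phase_quadratic_le hr hx hn θ) (Real.exp_pos _).le
    by_cases hmem : θ ∈ Set.Ioc (-Real.pi) Real.pi
    · rw [Set.indicator_of_mem hmem]
      linarith [hM θ]
    · rw [Set.indicator_of_notMem hmem, Set.indicator_of_notMem hmem, zero_sub, norm_neg,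
        Complex.norm_real, Real.norm_of_nonneg (Real.exp_pos _).le, add_zero]
      have h3 : 1 ≤ r * |θ| := by
        have h4 : Real.pi ≤ |θ| := by
          by_contra hlt
          push Not at hlt
          rw [abs_lt] at hlt
          exact hmem ⟨hlt.1, hlt.2.le⟩
        nlinarith [Real.pi_gt_three]
      refine le_trans ?_ g2
      refine le_trans ?_ (le_mul_of_one_le_left (Real.exp_pos _).le h3)
      exact Real.exp_le_exp.2 (by linarith)
  · have hgauss : Real.exp (-(r * n / 2) * θ ^ 2) ≤ 520 / x * Real.exp (-(r * n / 20) * θ ^ 2) := by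
      have h3 : 1 ≤ r * |θ| := by
        rw [div_lt_iff₀ hr0] at h
        linarith [Real.pi_gt_three]
      refine le_trans ?_ g2
      refine le_trans ?_ (le_mul_of_one_le_left (Real.exp_pos _).le h3)
      exact Real.exp_le_exp.2 (by linarith)
    refine (norm_sub_le _ _).trans ?_
    rw [Complex.norm_real, Real.norm_of_nonneg (Real.exp_pos _).le, add_comm]
    refine add_le_add hgauss ?_
    by_cases hmem : θ ∈ Set.Ioc (-Real.pi) Real.pi
    · rw [Set.indicator_of_mem hmem, Set.indicator_of_mem hmem, Complex.norm_exp]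
      exact Real.exp_le_exp.2 (phase_re_outer hr hx h (abs_le.2 ⟨hmem.1.le, hmem.2⟩))
    · rw [Set.indicator_of_notMem hmem, Set.indicator_of_notMem hmem, norm_zero]

lemma norm_integral_phase_sub_le (hr : 2 ≤ r) (hx : 2 ≤ x)
    (hn : (n : ℝ) * (x - 1) = x ^ (r + 1)) :
    ‖(∫ θ in (-Real.pi)..Real.pi, Complex.exp (phase n r x θ)) -
        ((√(2 * Real.pi / (r * n)) : ℝ) : ℂ)‖ ≤
      2080 / x * √(2 * Real.pi / (r * n)) +
        2 * Real.pi * Real.exp (-(x ^ (r - 1) / r ^ 3)) := by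
  have hx0 : 0 < x := by linarith
  have hr0 : (0 : ℝ) < r := by positivity
  have hn0 : (0 : ℝ) < n := lt_of_lt_of_le (by positivity) (pow_le_of_saddle hx hn)
  have hpi := Real.pi_pos
  have hle : -Real.pi ≤ Real.pi := by linarith
  have hcont : Continuous fun θ => Complex.exp (phase n r x θ) :=
    Complex.continuous_exp.comp (continuous_phase n r x)
  have hint1 : Integrable
      ((Set.Ioc (-Real.pi) Real.pi).indicator fun θ => Complex.exp (phase n r x θ)) := by
    rw [integrable_indicator_iff measurableSet_Ioc]
    exact (hcont.integrableOn_Icc).mono_set Set.Ioc_subset_Icc_self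
  have hint2 : Integrable fun θ : ℝ => ((Real.exp (-(r * n / 2) * θ ^ 2) : ℝ) : ℂ) :=
    (integrable_exp_neg_mul_sq (by positivity)).ofReal
  have hint3 : Integrable fun θ : ℝ => 520 / x * Real.exp (-(r * n / 20) * θ ^ 2) :=
    (integrable_exp_neg_mul_sq (by positivity)).const_mul _
  have hint4 : Integrable ((Set.Ioc (-Real.pi) Real.pi).indicator
      (fun _ : ℝ => Real.exp (-(x ^ (r - 1) / r ^ 3)))) := by
    rw [integrable_indicator_iff measurableSet_Ioc]
    exact integrableOn_const (by simp)
  have e1 : (∫ θ in (-Real.pi)..Real.pi, Complex.exp (phase n r x θ)) =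
      ∫ θ, (Set.Ioc (-Real.pi) Real.pi).indicator (fun θ => Complex.exp (phase n r x θ)) θ := by
    rw [intervalIntegral.integral_of_le hle, integral_indicator measurableSet_Ioc]
  have e2 : ((√(2 * Real.pi / (r * n)) : ℝ) : ℂ) =
      ∫ θ : ℝ, ((Real.exp (-(r * n / 2) * θ ^ 2) : ℝ) : ℂ) := by
    rw [integral_complex_ofReal, integral_gaussian]
    congr 2
    field_simp
  rw [e1, e2, ← integral_sub hint1 hint2]
  refine (norm_integral_le_of_norm_le (hint3.add hint4) (Filter.Eventually.of_forall
    (norm_indicator_sub_gaussian_le hr hx hn))).trans ?_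
  simp only [Pi.add_apply]
  rw [integral_add hint3 hint4, integral_const_mul, integral_gaussian,
    integral_indicator measurableSet_Ioc, setIntegral_const]
  refine add_le_add ?_ ?_
  · have h1 : √(Real.pi / (r * n / 20)) ≤ 4 * √(2 * Real.pi / (r * n)) := by
      rw [Real.sqrt_le_left (by positivity), mul_pow, Real.sq_sqrt (by positivity)]
      have h2 : Real.pi / (r * n / 20) = 10 * (2 * Real.pi / (r * n)) := by
        field_simp
        norm_num
      rw [h2]
      gcongr
      norm_num
    calc _ ≤ 520 / x * (4 * √(2 * Real.pi / (r * n))) := by gcongr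
      _ = _ := by ring
  · simp only [measureReal_def, Real.volume_Ioc, smul_eq_mul]
    rw [ENNReal.toReal_ofReal (by linarith)]
    exact le_of_eq (by ring)

end Saddle

/-! ### Stirling's formula with an error term, and choice of the saddle. -/

lemma exists_factorial_eq_stirling {n : ℕ} (hn : 1 ≤ n) : ∃ ρ : ℝ, |ρ - 1| ≤ 1 / n ∧
    (n ! : ℝ) = √(2 * Real.pi * n) * Real.exp (n * Real.log n - n) * ρ := by
  have hn0 : (0 : ℝ) < n := by positivity
  have hn1 : (1 : ℝ) ≤ n := by exact_mod_cast hn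
  have hpi : 0 < √Real.pi := Real.sqrt_pos.2 Real.pi_pos
  set s := Stirling.stirlingSeq n with hs
  have hlow : √Real.pi ≤ s := Stirling.sqrt_pi_le_stirlingSeq (by omega)
  have hs0 : 0 < s := hpi.trans_le hlow
  -- The sequence `log s_k - 1 / (12 k)` increases to `log √π`, because the bound on consecutive
  -- differences telescopes. Starting at `k + 1` avoids the index 0.
  have hup : Real.log s - 1 / (12 * n) ≤ Real.log (√Real.pi) := by
    have hmono : Monotone fun k : ℕ =>
        Real.log (Stirling.stirlingSeq (k + 1)) - 1 / (12 * ((k + 1 : ℕ) : ℝ)) := by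
      refine monotone_nat_of_le_succ fun k => ?_
      have h := Stirling.log_stirlingSeq_sdiff_le (k + 1)
      have e : 1 / (12 * ((k + 1 : ℕ) : ℝ) * (((k + 1 : ℕ) : ℝ) + 1)) =
          1 / (12 * ((k + 1 : ℕ) : ℝ)) - 1 / (12 * ((k + 1 + 1 : ℕ) : ℝ)) := by
        push_cast
        field_simp
        ring
      rw [e] at h
      linarith
    have hlim : Tendsto (fun k : ℕ =>
        Real.log (Stirling.stirlingSeq (k + 1)) - 1 / (12 * ((k + 1 : ℕ) : ℝ))) atTop
        (𝓝 (Real.log (√Real.pi))) := by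
      have h1 : Tendsto (fun k : ℕ => Real.log (Stirling.stirlingSeq k)) atTop
          (𝓝 (Real.log (√Real.pi))) :=
        (Real.continuousAt_log hpi.ne').tendsto.comp Stirling.tendsto_stirlingSeq_sqrt_pi
      have h2 : Tendsto (fun k : ℕ => 1 / (12 * (k : ℝ))) atTop (𝓝 0) := by
        have := (tendsto_one_div_atTop_nhds_zero_nat (𝕜 := ℝ)).const_mul (1 / 12)
        rw [mul_zero] at this
        refine this.congr fun k => ?_
        rw [div_mul_div_comm, one_mul]
      have h3 := (h1.sub h2).comp (tendsto_add_atTop_nat 1)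
      rw [sub_zero] at h3
      exact h3
    have h := hmono.ge_of_tendsto hlim (n - 1)
    rw [Nat.sub_add_cancel hn] at h
    exact h
  refine ⟨s / √Real.pi, ?_, ?_⟩
  · have h1 : 1 ≤ s / √Real.pi := by rwa [le_div_iff₀ hpi, one_mul]
    have h2 : s / √Real.pi ≤ Real.exp (1 / (12 * n)) := by
      rw [← Real.log_le_iff_le_exp (by positivity), Real.log_div hs0.ne' hpi.ne']
      linarith
    have ht : 1 / (12 * (n : ℝ)) ≤ 1 / 2 * (1 / n) := by
      rw [div_mul_div_comm, mul_one]
      gcongr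
      norm_num
    have ht1 : 1 / (n : ℝ) ≤ 1 := by rwa [div_le_one hn0]
    have h3 := Real.abs_exp_sub_one_le (x := 1 / (12 * n)) (by
      rw [abs_of_pos (by positivity)]
      linarith)
    rw [abs_of_pos (by positivity : (0 : ℝ) < 1 / (12 * n))] at h3
    rw [abs_of_nonneg (by linarith)]
    have h4 := (abs_le.1 h3).2
    linarith
  · have h1 : (n ! : ℝ) = s * (√(2 * n) * (n / Real.exp 1) ^ n) := by
      rw [hs, Stirling.stirlingSeq]
      field_simp
    have h2 : (n / Real.exp 1) ^ n = Real.exp (n * Real.log n - n) := by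
      rw [← Real.exp_log (by positivity : (0 : ℝ) < (n / Real.exp 1) ^ n), Real.log_pow,
        Real.log_div hn0.ne' (Real.exp_pos 1).ne', Real.log_exp]
      congr 1
      ring
    have h3 : √(2 * Real.pi * n) = √Real.pi * √(2 * n) := by
      rw [← Real.sqrt_mul Real.pi_pos.le]
      congr 1
      ring
    rw [h1, h2, h3]
    field_simp

lemma abs_exp_sub_one_le_of_abs_le {ε b : ℝ} (h : |ε| ≤ b) :
    |Real.exp ε - 1| ≤ Real.exp b * |ε| := by
  have h1 := norm_exp_sub_exp_le (a := (ε : ℂ)) (b := 0) (c := b)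
    (by rw [Complex.ofReal_re]; exact (le_abs_self ε).trans h)
    (by rw [Complex.zero_re]; exact (abs_nonneg ε).trans h)
  rw [Complex.exp_zero, sub_zero, ← Complex.ofReal_exp, ← Complex.ofReal_one,
    ← Complex.ofReal_sub, Complex.norm_real, Complex.norm_real] at h1
  exact h1

lemma abs_mul_mul_sub_one_le {a b c K δ : ℝ} (hK : 0 ≤ K) (hδ : 0 ≤ δ) (hδ1 : δ ≤ 1)
    (ha : |a - 1| ≤ K * δ) (hb : |b - 1| ≤ K * δ) (hc : |c - 1| ≤ K * δ) :
    |a * b * c - 1| ≤ K * ((1 + K) ^ 2 + (1 + K) + 1) * δ := by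
  have hKδ : K * δ ≤ K := mul_le_of_le_one_right hK hδ1
  have hb1 : |b| ≤ 1 + K := by
    have := abs_sub_abs_le_abs_sub b 1
    rw [abs_one] at this
    linarith
  have hc1 : |c| ≤ 1 + K := by
    have := abs_sub_abs_le_abs_sub c 1
    rw [abs_one] at this
    linarith
  have h1 : a * b * c - 1 = (a - 1) * (b * c) + (b - 1) * c + (c - 1) := by ring
  have h2 : |(a - 1) * (b * c)| ≤ K * δ * ((1 + K) * (1 + K)) := by
    rw [abs_mul, abs_mul]
    gcongr
  have h3 : |(b - 1) * c| ≤ K * δ * (1 + K) := by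
    rw [abs_mul]
    gcongr
  rw [h1]
  calc _ ≤ |(a - 1) * (b * c)| + |(b - 1) * c| + |c - 1| := abs_add_three _ _ _
    _ ≤ K * δ * ((1 + K) * (1 + K)) + K * δ * (1 + K) + K * δ := by gcongr
    _ = _ := by ring

/-- For `r ≥ 3`, `(2.7 / 2) ^ r ≥ 2`; for `r = 2` the number `e ^ 2` is below 8, hence the
assumption `8 ≤ n`. -/
lemma two_pow_succ_le_of_le_log {n r : ℕ} (hr : 2 ≤ r) (hn : 8 ≤ n)
    (hrn : (r : ℝ) ≤ Real.log n) : (2 : ℝ) ^ (r + 1) ≤ n := by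
  have hn0 : (0 : ℝ) < n := by positivity
  rcases hr.eq_or_lt with rfl | hr
  · norm_num
    exact_mod_cast hn
  · have h1 : Real.exp r ≤ n := (Real.le_log_iff_exp_le hn0).1 hrn
    have h2 : (2.7 : ℝ) ^ r ≤ Real.exp r := by
      rw [← Real.exp_one_pow]
      exact pow_le_pow_left₀ (by norm_num) (by linarith [Real.exp_one_gt_d9]) _
    have h3 : (1.35 : ℝ) ^ 3 ≤ 1.35 ^ r := pow_le_pow_right₀ (by norm_num) hr
    have h4 : (2.7 : ℝ) ^ r = 1.35 ^ r * 2 ^ r := by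
      rw [← mul_pow]
      norm_num
    have h5 : (0 : ℝ) < 2 ^ r := by positivity
    rw [pow_succ]
    norm_num at h3
    nlinarith

lemma exists_saddle {n r : ℕ} (hr : 2 ≤ r) (h : (2 : ℝ) ^ (r + 1) ≤ n) :
    ∃ x : ℝ, 2 ≤ x ∧ (n : ℝ) * (x - 1) = x ^ (r + 1) := by
  have h2 : (2 : ℝ) ≤ n := le_trans (by
    rw [pow_succ]
    linarith [one_le_pow₀ (one_le_two : (1 : ℝ) ≤ 2) (n := r)]) h
  have hc : ContinuousOn (fun x : ℝ => (n : ℝ) * (x - 1) - x ^ (r + 1)) (Set.Icc 2 n) := by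
    fun_prop
  have hmem : (0 : ℝ) ∈ Set.Icc ((n : ℝ) * ((n : ℝ) - 1) - (n : ℝ) ^ (r + 1))
      ((n : ℝ) * (2 - 1) - 2 ^ (r + 1)) := by
    constructor
    · have h3 : (n : ℝ) ^ 2 ≤ n ^ (r + 1) := pow_le_pow_right₀ (by linarith) (by omega)
      nlinarith
    · linarith
  obtain ⟨x, hx, hx0⟩ := intermediate_value_Icc' h2 hc hmem
  exact ⟨x, hx.1, by linarith⟩

lemma eventually_log_pow_le :
    ∀ᶠ n : ℕ in atTop, 2 * Real.log (n : ℝ) ^ 4 ≤ √(n : ℝ) := by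
  have h := (isLittleO_log_rpow_rpow_atTop 4 (by norm_num : (0 : ℝ) < 1 / 2)).def
    (by norm_num : (0 : ℝ) < 1 / 2)
  filter_upwards [tendsto_natCast_atTop_atTop.eventually h, eventually_ge_atTop 1] with n hn hn1
  have hlog : 0 ≤ Real.log (n : ℝ) := Real.log_natCast_nonneg n
  rw [Real.norm_of_nonneg (by positivity), Real.norm_of_nonneg (by positivity),
    ← Real.sqrt_eq_rpow] at hn
  have : Real.log (n : ℝ) ^ (4 : ℝ) = Real.log (n : ℝ) ^ 4 := by
    rw [← Real.rpow_natCast]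
    norm_num
  rw [this] at hn
  linarith

/-- As `r ≥ 2`, `x ≤ √n` and so `x ^ (r - 1) ≥ √n / 2`, which dominates `r ^ 3 * log n ≤ (log n) ^
4`. The outer arc then contributes at most a multiple of `1 / n`. -/
lemma log_mul_pow_le_of_saddle {n r : ℕ} {x : ℝ} (hr : 2 ≤ r) (hrn : (r : ℝ) ≤ Real.log n)
    (hlog : 2 * Real.log (n : ℝ) ^ 4 ≤ √(n : ℝ)) (hx : 2 ≤ x)
    (hn : (n : ℝ) * (x - 1) = x ^ (r + 1)) : Real.log n ≤ x ^ (r - 1) / r ^ 3 := by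
  have hr0 : (0 : ℝ) < r := by positivity
  have hx0 : 0 < x := by linarith
  have h1 : x ≤ √(n : ℝ) := by
    refine Real.le_sqrt_of_sq_le (le_trans ?_ (pow_le_of_saddle hx hn))
    exact pow_le_pow_right₀ (by linarith) hr
  have h2 : √(n : ℝ) / 2 ≤ x ^ (r - 1) := by
    have h3 := half_le_pow_of_saddle hx hn
    have h4 : x ^ r = x ^ (r - 1) * x := by rw [← pow_succ, Nat.sub_add_cancel (by omega)]
    have h5 : √(n : ℝ) * √(n : ℝ) = n := Real.mul_self_sqrt (Nat.cast_nonneg n)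
    refine le_of_mul_le_mul_right ?_ hx0
    rw [← h4]
    nlinarith [Real.sqrt_nonneg (n : ℝ)]
  rw [le_div_iff₀ (by positivity)]
  have h6 : Real.log (n : ℝ) * (r : ℝ) ^ 3 ≤ Real.log (n : ℝ) * Real.log (n : ℝ) ^ 3 := by
    gcongr
  have h7 : Real.log (n : ℝ) * Real.log (n : ℝ) ^ 3 = Real.log (n : ℝ) ^ 4 := by ring
  linarith

/-! ### Assembly of the asymptotic formula. -/

lemma abs_nu_mul_sub_one_le {n r : ℕ} {x : ℝ} (hr : 2 ≤ r) (hrn : (r : ℝ) ≤ Real.log n)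
    (hlog : 2 * Real.log (n : ℝ) ^ 4 ≤ √(n : ℝ)) (hx : 2 ≤ x)
    (hn : (n : ℝ) * (x - 1) = x ^ (r + 1)) :
    |nu n r * x ^ n * Real.exp (-∑ j ∈ Finset.Icc 1 r, x ^ j / j) * √(2 * Real.pi * (r * n)) - 1| ≤
      2084 * (1 / x) := by
  have hx0 : 0 < x := by linarith
  have hr0 : (0 : ℝ) < r := by positivity
  have hn0 : (0 : ℝ) < n := lt_of_lt_of_le (by positivity) (pow_le_of_saddle hx hn)
  have hpi := Real.pi_pos
  set t := nu n r * x ^ n * Real.exp (-∑ j ∈ Finset.Icc 1 r, x ^ j / j) with ht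
  set D := √(2 * Real.pi * (r * n)) with hD
  set G := √(2 * Real.pi / (r * n)) with hG
  have hJ : (∫ θ in (-Real.pi)..Real.pi, Complex.exp (phase n r x θ)) =
      ((2 * Real.pi * t : ℝ) : ℂ) := by
    have h := nu_eq_integral n r hx0
    rw [← ht] at h
    have hpi' : ((2 * Real.pi : ℝ) : ℂ) ≠ 0 :=
      Complex.ofReal_ne_zero.2 (by positivity)
    rw [Complex.ofReal_inv, eq_inv_mul_iff_mul_eq₀ hpi'] at h
    rw [Complex.ofReal_mul]
    exact h.symm
  have h1 := norm_integral_phase_sub_le hr hx hn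
  rw [hJ, ← hG, ← Complex.ofReal_sub, Complex.norm_real, Real.norm_eq_abs] at h1
  have hDG : D * G = 2 * Real.pi := by
    rw [hD, hG, ← Real.sqrt_mul (by positivity)]
    rw [show 2 * Real.pi * (r * n) * (2 * Real.pi / (r * n)) = (2 * Real.pi) ^ 2 by field_simp]
    exact Real.sqrt_sq (by positivity)
  have hD0 : 0 ≤ D := Real.sqrt_nonneg _
  have hM : Real.exp (-(x ^ (r - 1) / r ^ 3)) ≤ 1 / n := by
    have := log_mul_pow_le_of_saddle hr hrn hlog hx hn
    calc _ ≤ Real.exp (-Real.log n) := Real.exp_le_exp.2 (by linarith)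
      _ = 1 / n := by rw [Real.exp_neg, Real.exp_log hn0, one_div]
  have hDx : D * (1 / n) ≤ 4 * (1 / x) := by
    rw [mul_one_div, mul_one_div, div_le_div_iff₀ hn0 hx0]
    refine (sq_le_sq₀ (by positivity) (by positivity)).1 ?_
    rw [mul_pow, hD, Real.sq_sqrt (by positivity)]
    have h2 := sq_mul_natCast_le_of_saddle hr hx hn
    calc 2 * Real.pi * (r * n) * x ^ 2 = 2 * Real.pi * n * (x ^ 2 * r) := by ring
      _ ≤ 2 * Real.pi * n * (2 * n) := by gcongr
      _ = 4 * Real.pi * (n : ℝ) ^ 2 := by ring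
      _ ≤ 16 * (n : ℝ) ^ 2 := by
          gcongr
          linarith [Real.pi_le_four]
      _ = _ := by ring
  have h2 : t * D - 1 = D / (2 * Real.pi) * (2 * Real.pi * t - G) := by
    field_simp
    linear_combination hDG
  rw [h2, abs_mul, abs_of_nonneg (by positivity)]
  calc D / (2 * Real.pi) * |2 * Real.pi * t - G| ≤
        D / (2 * Real.pi) * (2080 / x * G + 2 * Real.pi * (1 / n)) := by
        refine mul_le_mul_of_nonneg_left (h1.trans ?_) (by positivity)
        gcongr
    _ = 2080 * (1 / x) * (D * G / (2 * Real.pi)) + D * (1 / n) := by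
        field_simp
    _ ≤ 2080 * (1 / x) * 1 + 4 * (1 / x) := by
        rw [hDG, div_self (by positivity)]
        gcongr
    _ = _ := by ring

/-- The main term of the asymptotic formula. -/
noncomputable def mainTerm (n r : ℕ) : ℝ :=
  1 / Real.sqrt (r : ℝ) * (n : ℝ) ^ ((n : ℝ) * (1 - 1 / (r : ℝ))) *
    Real.exp (∑ N ∈ Finset.range (r + 1), dCoeff r N * (n : ℝ) ^ (((r : ℝ) - (N : ℝ)) / (r : ℝ)))

lemma mainTerm_pos {n r : ℕ} (hn : 1 ≤ n) (hr : 2 ≤ r) : 0 < mainTerm n r := by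
  have hn0 : (0 : ℝ) < n := by positivity
  have hr0 : (0 : ℝ) < r := by positivity
  unfold mainTerm
  have := Real.rpow_pos_of_pos hn0 ((n : ℝ) * (1 - 1 / (r : ℝ)))
  positivity

/-- Separates the exponential factor of Stirling's formula from the expansion in
`exponent_estimate`; the summand `N = 0` supplies `-n + n / r`. -/
lemma mainTerm_eq {n r : ℕ} (hn : 1 ≤ n) (hr : 2 ≤ r) :
    mainTerm n r = 1 / Real.sqrt (r : ℝ) * (Real.exp (n * Real.log n - n) *
      Real.exp (-((n : ℝ) / r) * Real.log n + n / r + ∑ N ∈ Finset.Icc 1 (r - 1),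
        dCoeff r N * (n : ℝ) ^ (((r : ℝ) - N) / r) + dCoeff r r)) := by
  have hn0 : (0 : ℝ) < n := by positivity
  have hr0 : (r : ℝ) ≠ 0 := by positivity
  obtain ⟨k, rfl⟩ := Nat.exists_eq_add_of_le' (show 1 ≤ r by omega)
  have hsum := sum_range_succ_eq_zero_add_sum_Icc
    (fun N => dCoeff (k + 1) N * (n : ℝ) ^ ((((k + 1 : ℕ) : ℝ) - (N : ℝ)) / ((k + 1 : ℕ) : ℝ))) (k + 1)
  rw [Finset.sum_Icc_succ_top (by omega), sub_self, zero_div, Real.rpow_zero, mul_one,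
    Nat.cast_zero, sub_zero, div_self hr0, Real.rpow_one] at hsum
  have h0 : dCoeff (k + 1) 0 = -1 + 1 / ((k + 1 : ℕ) : ℝ) := by simp [dCoeff]
  unfold mainTerm
  rw [hsum, h0, mul_assoc, Real.rpow_def_of_pos hn0, ← Real.exp_add, ← Real.exp_add,
    Nat.add_sub_cancel]
  congr 2
  ring

lemma one_div_le_rpow_of_saddle {n r : ℕ} {x : ℝ} (hr : 2 ≤ r) (hx : 2 ≤ x)
    (hn : (n : ℝ) * (x - 1) = x ^ (r + 1)) : 1 / x ≤ 2 * (n : ℝ) ^ (-(1 / (r : ℝ))) := by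
  have hx0 : 0 < x := by linarith
  have hr0 : (r : ℝ) ≠ 0 := by positivity
  have hn0 : (0 : ℝ) < n := lt_of_lt_of_le (by positivity) (pow_le_of_saddle hx hn)
  have h1 : (n : ℝ) ≤ (2 * x) ^ r := by
    have h2 := half_le_pow_of_saddle hx hn
    have h3 : (2 : ℝ) ≤ 2 ^ r := by
      calc (2 : ℝ) = 2 ^ 1 := by norm_num
        _ ≤ 2 ^ r := pow_le_pow_right₀ (by norm_num) (by omega)
    rw [mul_pow]
    nlinarith [pow_pos hx0 r]
  have h2 : (n : ℝ) ^ (1 / (r : ℝ)) ≤ 2 * x := by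
    calc (n : ℝ) ^ (1 / (r : ℝ)) ≤ ((2 * x) ^ r) ^ (1 / (r : ℝ)) :=
          Real.rpow_le_rpow hn0.le h1 (by positivity)
      _ = 2 * x := by
          rw [← Real.rpow_natCast (2 * x) r, ← Real.rpow_mul (by positivity), mul_one_div_cancel hr0,
            Real.rpow_one]
  have h3 : 0 < (n : ℝ) ^ (1 / (r : ℝ)) := Real.rpow_pos_of_pos hn0 _
  rw [Real.rpow_neg hn0.le, ← div_eq_mul_inv, div_le_div_iff₀ hx0 h3]
  linarith

lemma exists_uniform_bound : ∃ (C : ℝ) (n₀ : ℕ), ∀ n r : ℕ, n₀ ≤ n → 2 ≤ r →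
    (r : ℝ) ≤ Real.log (n : ℝ) →
      |(n ! : ℝ) * nu n r / mainTerm n r - 1| ≤ C * (n : ℝ) ^ (-(1 / (r : ℝ))) := by
  obtain ⟨n₁, hn₁⟩ := eventually_atTop.1 eventually_log_pow_le
  -- One constant for all three factors: Stirling needs 1, the exponent `8 * exp 4` (as `8 / x ≤
  -- 4`), the integral 2084.
  set K := 2084 + 8 * Real.exp 4 with hK
  have hK0 : 0 ≤ K := by positivity
  refine ⟨K * ((1 + K) ^ 2 + (1 + K) + 1) * 2, max 8 n₁, fun n r hn hr hrn => ?_⟩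
  have hn8 : 8 ≤ n := (le_max_left _ _).trans hn
  have hlog := hn₁ n ((le_max_right _ _).trans hn)
  obtain ⟨x, hx, hnx⟩ := exists_saddle hr (two_pow_succ_le_of_le_log hr hn8 hrn)
  have hx0 : 0 < x := by linarith
  have hr0 : (0 : ℝ) < r := by positivity
  have hr1 : (1 : ℝ) ≤ r := by exact_mod_cast (by omega : 1 ≤ r)
  have hn0 : (0 : ℝ) < n := by positivity
  have hx1 : 1 / x ≤ 1 / 2 := by gcongr
  have hxp : 0 < 1 / x := by positivity
  have he4 := Real.exp_pos 4
  obtain ⟨ρ, hρ, hfact⟩ := exists_factorial_eq_stirling (n := n) (by omega)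
  have hE := exponent_estimate hr hx hnx
  have hτ := abs_nu_mul_sub_one_le hr hrn hlog hx hnx
  set P := ∑ j ∈ Finset.Icc 1 r, x ^ j / (j : ℝ) with hP
  set T := -((n : ℝ) / r) * Real.log n + n / r + ∑ N ∈ Finset.Icc 1 (r - 1),
        dCoeff r N * (n : ℝ) ^ (((r : ℝ) - N) / r) + dCoeff r r with hT
  set ε := P - n * Real.log x - T with hε
  set τ := nu n r * x ^ n * Real.exp (-P) * √(2 * Real.pi * (r * n)) with hτdef
  have hmain : (n ! : ℝ) * nu n r / mainTerm n r = ρ * Real.exp ε * τ := by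
    rw [div_eq_iff (mainTerm_pos (by omega) hr).ne', mainTerm_eq (by omega) hr, ← hT, hfact, hτdef]
    have h1 : √(2 * Real.pi * (r * n)) = √r * √(2 * Real.pi * n) := by
      rw [← Real.sqrt_mul hr0.le]
      congr 1
      ring
    have h2 : Real.exp ε * x ^ n * Real.exp (-P) * Real.exp T = 1 := by
      have h3 : x ^ n = Real.exp (n * Real.log x) := by
        rw [mul_comm, ← Real.rpow_def_of_pos hx0, Real.rpow_natCast]
      rw [h3, ← Real.exp_add, ← Real.exp_add, ← Real.exp_add, Real.exp_eq_one_iff, hε]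
      ring
    have h4 : √(r : ℝ) ≠ 0 := (Real.sqrt_pos.2 hr0).ne'
    rw [h1]
    field_simp
    linear_combination (-(ρ * nu n r)) * h2
  rw [hmain]
  have hρ' : |ρ - 1| ≤ K * (1 / x) := by
    have h1 : 1 / (n : ℝ) ≤ 1 / x := by
      gcongr
      have := mul_natCast_le_of_saddle hr hx hnx
      nlinarith
    have h2 : 1 * (1 / x) ≤ K * (1 / x) := by
      gcongr
      linarith
    linarith
  have hε' : |Real.exp ε - 1| ≤ K * (1 / x) := by
    have h1 : |ε| ≤ 4 := by
      refine hE.trans ?_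
      rw [div_le_iff₀ hx0]
      linarith
    calc _ ≤ Real.exp 4 * |ε| := abs_exp_sub_one_le_of_abs_le h1
      _ ≤ Real.exp 4 * (8 / x) := by gcongr
      _ = (8 * Real.exp 4) * (1 / x) := by ring
      _ ≤ K * (1 / x) := by
        gcongr
        linarith
  have hτ' : |τ - 1| ≤ K * (1 / x) := by
    refine hτ.trans ?_
    gcongr
    linarith
  calc _ ≤ K * ((1 + K) ^ 2 + (1 + K) + 1) * (1 / x) :=
        abs_mul_mul_sub_one_le hK0 hxp.le (by linarith) hρ' hε' hτ'
    _ ≤ K * ((1 + K) ^ 2 + (1 + K) + 1) * (2 * (n : ℝ) ^ (-(1 / (r : ℝ)))) := by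
        gcongr
        exact one_div_le_rpow_of_saddle hr hx hnx
    _ = _ := by ring

theorem theorem1 :
    ∃ C : ℝ, ∀ n r : ℕ, 2 ≤ r → (r : ℝ) ≤ Real.log (n : ℝ) →
      ∃ B : ℝ, |B| ≤ C ∧
        (n ! : ℝ) * nu n r =
          1 / Real.sqrt (r : ℝ) * (n : ℝ) ^ ((n : ℝ) * (1 - 1 / (r : ℝ))) *
            Real.exp (∑ N ∈ Finset.range (r + 1),
              dCoeff r N * (n : ℝ) ^ (((r : ℝ) - (N : ℝ)) / (r : ℝ))) *
            (1 + B * (n : ℝ) ^ (-(1 / (r : ℝ)))) := by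
  obtain ⟨C, n₀, hC⟩ := exists_uniform_bound
  -- `F n r` is the only possible `B`: the asserted equation solved for it.
  let F : ℕ → ℕ → ℝ := fun n r =>
    ((n ! : ℝ) * nu n r / mainTerm n r - 1) / (n : ℝ) ^ (-(1 / (r : ℝ)))
  set S := ∑ n ∈ Finset.range n₀, ∑ r ∈ Finset.range n₀, |F n r| with hS
  refine ⟨max C S, fun n r hr hrn => ⟨F n r, ?_, ?_⟩⟩
  all_goals
    have hn : 1 ≤ n := by
      rcases Nat.eq_zero_or_pos n with rfl | h
      · have : (2 : ℝ) ≤ r := by exact_mod_cast hr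
        simp only [Nat.cast_zero, Real.log_zero] at hrn
        linarith
      · exact h
    have hn0 : (0 : ℝ) < n := by positivity
    have hpow : 0 < (n : ℝ) ^ (-(1 / (r : ℝ))) := Real.rpow_pos_of_pos hn0 _
  · rcases le_or_gt n₀ n with h | h
    · refine le_trans ?_ (le_max_left _ _)
      rw [abs_div, abs_of_pos hpow, div_le_iff₀ hpow]
      exact hC n r h hr hrn
    · refine le_trans ?_ (le_max_right _ _)
      -- Because `r ≤ log n < n`, the pairs with `n < n₀` lie in a finite square, over which `S`
      -- sums.
      have hrn' : r < n := by
        have := Real.log_le_sub_one_of_pos hn0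
        exact_mod_cast (by linarith : (r : ℝ) < n)
      calc |F n r| ≤ ∑ r ∈ Finset.range n₀, |F n r| :=
            Finset.single_le_sum (f := fun r => |F n r|) (fun _ _ => abs_nonneg _)
              (Finset.mem_range.2 (hrn'.trans h))
        _ ≤ S := Finset.single_le_sum (f := fun n => ∑ r ∈ Finset.range n₀, |F n r|)
              (fun _ _ => Finset.sum_nonneg fun _ _ => abs_nonneg _) (Finset.mem_range.2 h)
  · change _ = mainTerm n r * _
    have hm := (mainTerm_pos hn hr).ne'
    rw [div_mul_cancel₀ _ hpow.ne']
    field_simp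
    ring
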